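/- Let $N\ge 1$, let $\Omega\subset\mathbb R^N$ be a bounded open set, let $\omega\subset\Omega$ be a non-empty open set, and let $0<\mu\le 1$, $0\le\nu\le 1$, $T>0$. Let $A_B$ be a non-negative selfadjoint operator on the real space $L^2(\Omega)$ whose domain $D(A_B)$, with the graph norm, embeds compactly into $L^2(\Omega)$, and whose first eigenvalue is positive. Let $\mathcal E_B$ be the closed symmetric form associated with $A_B$, $V_{1/2}$ its domain (the completion in $L^2(\Omega)$ of $D(A_B)$ for the norm $((A_Bu,u)+\|u\|^2)^{1/2}$), and $V_{-1/2}$ the dual of $V_{1/2}$ with pivot space $L^2(\Omega)$. For $\alpha>0$ let $\mathbb I_{t,T}^{\alpha}u(t)=\frac1{\Gamma(\alpha)}\int_t^T(\tau-t)^{\alpha-1}u(\tau)\,d\tau$, let $\mathbb I_{t,T}^0u=u$, and let $$\mathbb D_{t,T}^{\mu,1-\nu}v=-\,\mathbb I_{t,T}^{(1-\nu)(1-\mu)}\frac{d}{dt}\Big(\mathbb I_{t,T}^{\nu(1-\mu)}v\Big),$$ where the integrals are Bochner integrals that are required to exist, $d/dt$ is the derivative of a locally absolutely continuous function on $[0,T)$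 with values in $V_{-1/2}$ (a primitive of a locally integrable function), and the identity defining $\mathbb D_{t,T}^{\mu,1-\nu}v$ is understood for almost every $t\in(0,T)$. Given $v_0\in L^2(\Omega)$, a weak solution of the backward system $$\mathbb D_{t,T}^{\mu,1-\nu}v+A_Bv=0\ \text{ in }\Omega\times(0,T),\qquad \mathbb I_{t,T}^{\nu(1-\mu)}v(\cdot,T)=v_0\ \text{ in }\Omega,$$ is a function $v\in C([0,T);V_{1/2})$ with $\mathbb I_{t,T}^{\nu(1-\mu)}v\in C([0,T];L^2(\Omega))$ having the value $v_0$ at $t=T$ (as the limit for $t\uparrow T$), with $\mathbb D_{t,T}^{\mu,1-\nu}v\in C([0,T);V_{-1/2})$, and such that for every $\varphi\in V_{1/2}$ and a.e. $t\in(0,T)$ $$\langle \mathbb D_{t,T}^{\mu,1-\nu}v(\cdot,t),\varphi\rangle_{V_{-1/2},V_{1/2}}+\mathcal E_B(v(\cdot,t),\varphi)=0 .$$ Assume that $A_B$ has the unique continuation property: if $\lambda>0$, $\varphi\in D(A_B)$, $A_B\varphi=\lambda\varphi$ and $\varphi=0$ a.e. in $\omega$, then $\varphi=0$ a.e. in $\Omega$.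 Let $v_0\in L^2(\Omega)$ and let $v$ be a weak solution of the backward system. If $v=0$ on $\omega\times(0,T)$, that is, $v(\cdot,t)=0$ a.e. in $\omega$ for a.e. $t\in(0,T)$, then $v=0$ on $\Omega\times(0,T)$: for every $t\in(0,T)$, $v(\cdot,t)=0$ a.e. in $\Omega$. -/

import Mathlib

open Set Filter Topology MeasureTheory
open scoped InnerProductSpace

noncomputable section

/-! ### Right-sided fractional calculus on `(0,T)` -/

section FractionalCalculus

variable {X : Type*} [NormedAddCommGroup X] [NormedSpace ℝ X]

/-- The right Riemann-Liouville fractional integral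
`I_{t,T}^α u (t) = Γ(α)⁻¹ ∫_t^T (τ - t)^(α-1) u(τ) dτ` for `α > 0`, and `I_{t,T}^0 u = u`. -/
def rightRL (T α : ℝ) (u : ℝ → X) (t : ℝ) : X :=
  if α = 0 then u t
  else (Real.Gamma α)⁻¹ • ∫ τ in Ioo t T, (τ - t) ^ (α - 1) • u τ

/-- The integral that defines `I_{t,T}^α u (t)` exists as a Bochner integral
(no condition for `α = 0`). -/
def RightRLExists (T α : ℝ) (u : ℝ → X) (t : ℝ) : Prop :=
  α = 0 ∨ IntegrableOn (fun τ => (τ - t) ^ (α - 1) • u τ) (Ioo t T)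

/-- `d` is (a representative of) the right Hilfer derivative
`D_{t,T}^{μ,ν} u = - I_{t,T}^{ν(1-μ)} (d/dt) (I_{t,T}^{(1-ν)(1-μ)} u)` on `(0,T)`:
the function `I_{t,T}^{(1-ν)(1-μ)} u` is locally absolutely continuous on `[0,T)` with
derivative `w'` (that is, it is a primitive of the locally integrable function `w'`), and
`d = - I_{t,T}^{ν(1-μ)} w'` almost everywhere, where all the integrals exist. -/
def HasRightHilferDeriv (T μ ν : ℝ) (u d : ℝ → X) : Prop :=
  (∀ t ∈ Ico 0 T, RightRLExists T ((1 - ν) * (1 - μ)) u t) ∧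
  ∃ w' : ℝ → X, LocallyIntegrableOn w' (Ico 0 T) ∧
    (∀ s ∈ Ico 0 T, ∀ t ∈ Ico 0 T,
      rightRL T ((1 - ν) * (1 - μ)) u t - rightRL T ((1 - ν) * (1 - μ)) u s
        = ∫ τ in s..t, w' τ) ∧
    ∀ᵐ t ∂(volume.restrict (Ioo 0 T)),
      RightRLExists T (ν * (1 - μ)) w' t ∧ d t = - rightRL T (ν * (1 - μ)) w' t

end FractionalCalculus

/-! ### Non-negative selfadjoint operators with compact resolvent and their forms -/

/-- A (densely defined, unbounded) non-negative selfadjoint operator on the real Hilbert space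
`H` whose domain, with the graph norm, embeds compactly into `H`, and whose first eigenvalue
is positive (by non-negativity: `0` is not an eigenvalue). -/
structure EllipticOperator (H : Type*) [NormedAddCommGroup H] [InnerProductSpace ℝ H]
    [CompleteSpace H] where
  op : H →ₗ.[ℝ] H
  selfAdjoint : IsSelfAdjoint op
  nonneg : ∀ x : op.domain, 0 ≤ ⟪op x, (x : H)⟫_ℝ
  compact : IsCompactOperator (fun p : op.graph => (p : H × H).1)
  ker_eq_zero : ∀ x : op.domain, op x = 0 → x = 0

namespace EllipticOperator

variable {H : Type*} [NormedAddCommGroup H] [InnerProductSpace ℝ H] [CompleteSpace H]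

theorem symm (A : EllipticOperator H) (x y : A.op.domain) :
    ⟪A.op x, (y : H)⟫_ℝ = ⟪(x : H), A.op y⟫_ℝ := by
  have h := LinearPMap.adjoint_isFormalAdjoint A.selfAdjoint.dense_domain
  rw [LinearPMap.isSelfAdjoint_def.mp A.selfAdjoint] at h
  exact h x y

/-- The domain of the operator, to be equipped with the form inner product. -/
def FormCore (A : EllipticOperator H) : Type _ := A.op.domain

instance (A : EllipticOperator H) : AddCommGroup A.FormCore :=
  inferInstanceAs (AddCommGroup A.op.domain)

instance (A : EllipticOperator H) : Module ℝ A.FormCore :=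
  inferInstanceAs (Module ℝ A.op.domain)

/-- The inclusion of the domain into `H`. -/
def incl (A : EllipticOperator H) : A.FormCore →ₗ[ℝ] H := A.op.domain.subtype

/-- The operator as a linear map on its domain. -/
def app (A : EllipticOperator H) : A.FormCore →ₗ[ℝ] H := A.op.toFun

/-- The form inner product `(A x, y) + (x, y)` on the domain of `A`. -/
abbrev formCore (A : EllipticOperator H) : InnerProductSpace.Core ℝ A.FormCore where
  inner x y := ⟪A.app x, A.incl y⟫_ℝ + ⟪A.incl x, A.incl y⟫_ℝ
  conj_inner_symm x y := by
    have h : ⟪A.app x, A.incl y⟫_ℝ = ⟪A.incl x, A.app y⟫_ℝ := A.symm x y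
    simp only [conj_trivial]
    rw [h, real_inner_comm (A.incl y) (A.incl x), real_inner_comm (A.app y)]
  re_inner_nonneg x := by
    have h : 0 ≤ ⟪A.app x, A.incl x⟫_ℝ := A.nonneg x
    have h' : 0 ≤ ⟪A.incl x, A.incl x⟫_ℝ := real_inner_self_nonneg
    exact add_nonneg h h'
  add_left x y z := by
    simp only [map_add, inner_add_left]; ring
  smul_left x y r := by
    simp only [map_smul, real_inner_smul_left, conj_trivial]; ring
  definite x hx := by
    have h : 0 ≤ ⟪A.app x, A.incl x⟫_ℝ := A.nonneg x
    have h' : 0 ≤ ⟪A.incl x, A.incl x⟫_ℝ := real_inner_self_nonneg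
    have h0 : ⟪A.incl x, A.incl x⟫_ℝ = 0 := by
      have : ⟪A.app x, A.incl x⟫_ℝ + ⟪A.incl x, A.incl x⟫_ℝ = 0 := hx
      linarith
    exact Subtype.ext (inner_self_eq_zero.mp h0)

instance (A : EllipticOperator H) : NormedAddCommGroup A.FormCore :=
  @InnerProductSpace.Core.toNormedAddCommGroup ℝ A.FormCore _ _ _ A.formCore

instance (A : EllipticOperator H) : InnerProductSpace ℝ A.FormCore :=
  InnerProductSpace.ofCore A.formCore.toCore

theorem inner_formCore (A : EllipticOperator H) (x y : A.FormCore) :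
    ⟪x, y⟫_ℝ = ⟪A.app x, A.incl y⟫_ℝ + ⟪A.incl x, A.incl y⟫_ℝ := rfl

theorem norm_incl_le (A : EllipticOperator H) (x : A.FormCore) : ‖A.incl x‖ ≤ 1 * ‖x‖ := by
  have h : 0 ≤ ⟪A.app x, A.incl x⟫_ℝ := A.nonneg x
  have h1 := A.inner_formCore x x
  rw [real_inner_self_eq_norm_sq, real_inner_self_eq_norm_sq] at h1
  rw [one_mul]
  exact le_of_sq_le_sq (by linarith) (norm_nonneg _)

/-- The form domain `V_{1/2}`: the completion of the domain of `A` for the form norm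
`((A x, x) + ‖x‖²)^(1/2)`. It is a Hilbert space, and it is a subspace of `H` through the
injective map `toH`. -/
abbrev V (A : EllipticOperator H) : Type _ := UniformSpace.Completion A.FormCore

/-- The dual `V_{-1/2}` of `V_{1/2}`. -/
abbrev VDual (A : EllipticOperator H) : Type _ := StrongDual ℝ A.V

/-- The embedding `V_{1/2} ↪ H`, the continuous extension of the inclusion `D(A) ⊆ H`. -/
def toH (A : EllipticOperator H) : A.V →L[ℝ] H :=
  (A.incl.mkContinuous 1 A.norm_incl_le).extend
    (UniformSpace.Completion.toComplL (𝕜 := ℝ) (E := A.FormCore))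

/-- The embedding `H ↪ V_{-1/2}` with pivot space `H`: `h ↦ (h, ·)_H`. -/
def toDual (A : EllipticOperator H) : H →L[ℝ] A.VDual :=
  ((ContinuousLinearMap.compL ℝ A.V H ℝ).flip A.toH).comp (innerSL ℝ)

/-- The closed form `E(u, φ)` of `A` on `V_{1/2}`. -/
def form (A : EllipticOperator H) (u φ : A.V) : ℝ :=
  ⟪u, φ⟫_ℝ - ⟪A.toH u, A.toH φ⟫_ℝ

theorem toH_coe (A : EllipticOperator H) (x : A.FormCore) :
    A.toH (x : A.V) = A.incl x := by
  have hd : DenseRange (UniformSpace.Completion.toComplL (𝕜 := ℝ) (E := A.FormCore)) :=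
    UniformSpace.Completion.denseRange_coe
  have hu : IsUniformInducing (UniformSpace.Completion.toComplL (𝕜 := ℝ) (E := A.FormCore)) :=
    UniformSpace.Completion.isUniformInducing_coe _
  exact ContinuousLinearMap.extend_eq (A.incl.mkContinuous 1 A.norm_incl_le) hd hu x

theorem toDual_apply (A : EllipticOperator H) (h : H) (φ : A.V) :
    A.toDual h φ = ⟪h, A.toH φ⟫_ℝ := rfl

/-- On the domain of `A` the form is `(A x, y)_H`. -/
theorem form_coe (A : EllipticOperator H) (x y : A.FormCore) :
    A.form (x : A.V) (y : A.V) = ⟪A.app x, A.incl y⟫_ℝ := by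
  rw [form, toH_coe, toH_coe, UniformSpace.Completion.inner_coe, inner_formCore]
  ring

/-- The form represents the operator: `E(x, φ) = (A x, φ)_H` for `x ∈ D(A)`, `φ ∈ V_{1/2}`. -/
theorem form_coe_left (A : EllipticOperator H) (x : A.FormCore) (φ : A.V) :
    A.form (x : A.V) φ = ⟪A.app x, A.toH φ⟫_ℝ := by
  have hc1 : Continuous fun φ : A.V => A.form (x : A.V) φ := by
    unfold form; fun_prop
  have hc2 : Continuous fun φ : A.V => ⟪A.app x, A.toH φ⟫_ℝ := by fun_prop
  refine congrFun (UniformSpace.Completion.denseRange_coe.equalizer hc1 hc2 ?_) φ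
  funext y
  simp only [Function.comp_apply]
  rw [form_coe, toH_coe]

/-- The form is closed: its completed domain is a subspace of `H`. -/
theorem toH_injective (A : EllipticOperator H) : Function.Injective A.toH := by
  rw [injective_iff_map_eq_zero]
  intro ξ hξ
  have key : ∀ x : A.FormCore, ⟪(x : A.V), ξ⟫_ℝ = 0 := by
    intro x
    have h := A.form_coe_left x ξ
    rw [form, hξ] at h
    simpa using h
  have hc : Continuous fun y : A.V => ⟪y, ξ⟫_ℝ := by fun_prop
  have h0 := congrFun (UniformSpace.Completion.denseRange_coe.equalizer hc
    (continuous_const (y := (0 : ℝ))) (by funext x; exact key x)) ξ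
  exact inner_self_eq_zero.mp h0

/-- `v` is a weak solution on `(0,T)` of the backward system
`D_{t,T}^{μ,1-ν} v + A v = 0`, `(I_{t,T}^{ν(1-μ)} v)(T) = v₀`.
Only the values of `v` on `[0,T)` matter. The function `I_{t,T}^{ν(1-μ)} v` is in
`C([0,T]; H)` with value `v₀` at `T`, that is, it exists and is continuous on `[0,T)` and tends
to `v₀` at `T`. -/
structure IsWeakBackwardSolution (A : EllipticOperator H) (T μ ν : ℝ) (v₀ : H)
    (v : ℝ → A.V) : Prop where
  continuousOn : ContinuousOn v (Ico 0 T)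
  rl_exists : ∀ t ∈ Ico 0 T, RightRLExists T (ν * (1 - μ)) (fun τ => A.toH (v τ)) t
  rl_continuousOn :
    ContinuousOn (rightRL T (ν * (1 - μ)) (fun τ => A.toH (v τ))) (Ico 0 T)
  final_condition :
    Tendsto (rightRL T (ν * (1 - μ)) (fun τ => A.toH (v τ))) (𝓝[<] T) (𝓝 v₀)
  equation : ∃ d : ℝ → A.VDual,
    HasRightHilferDeriv T μ (1 - ν) (fun τ => A.toDual (A.toH (v τ))) d ∧
    ContinuousOn d (Ico 0 T) ∧
    ∀ φ : A.V, ∀ᵐ t ∂(volume.restrict (Ioo 0 T)), d t φ + A.form (v t) φ = 0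

end EllipticOperator

/-- The real space `L²(Ω)`. -/
abbrev L2 {N : ℕ} (Ω : Set (EuclideanSpace ℝ (Fin N))) : Type :=
  Lp ℝ 2 (volume.restrict Ω)

/-- The unique continuation property of `A` from `ω`: an eigenfunction to a positive eigenvalue
which vanishes in `ω` vanishes in `Ω`. -/
def UniqueContinuation {N : ℕ} {Ω : Set (EuclideanSpace ℝ (Fin N))}
    (A : EllipticOperator (L2 Ω)) (ω : Set (EuclideanSpace ℝ (Fin N))) : Prop :=
  ∀ l : ℝ, 0 < l → ∀ φ : A.op.domain, A.op φ = l • (φ : L2 Ω) →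
    (∀ᵐ x ∂(volume.restrict ω), (φ : L2 Ω) x = 0) →
    ∀ᵐ x ∂(volume.restrict Ω), (φ : L2 Ω) x = 0

end

/-! ### Fractional integrals and the truncated Laplace transform -/

/-! Write γ = (1-ν)(1-μ), and take the Laplace transform of the equation in the reversed time T - t,
but only over (0,T). A fractional integral of order α is a convolution, so truncation costs only a
tail of relative size e^(-pT) (`laplace_rightRL`). For every h this gives ∫₀ᵀ e^(-p(T-t)) (v(t), h)
dt = p^(-γ) (v₀, (p^μ + A)⁻¹ h) + O(p e^(-pT)) (`exists_laplace_estimate`).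

If h is supported in ω, the left side vanishes, so (v₀, (p^μ + A)⁻¹ h) is O(p² e^(-pT)). As μ ≤ 1,
in the variable z with (z+1)² = p^μ this matrix element is a bounded holomorphic function on the
right half-plane with Gaussian decay on the positive axis; by Phragmén–Lindelöf it is zero
(`inner_resolvent_eq_zero_of_decay`). The vectors orthogonal to all these (q + A)⁻¹ h form a space
invariant under the compact selfadjoint resolvent. An eigenvector in it would vanish in ω, against
unique continuation, so the space is zero and v₀ = 0 (`eq_zero_of_resolvents_orthogonal`).

With v₀ = 0 the estimate, now for arbitrary h, says that the moments ∫₀ᵀ e^(nt) (v(t), h) dt grow at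
most linearly in n. Such moments force the function to vanish (`integral_eq_zero_of_exp_moments`).
-/

theorem rightRL_clm {X Y : Type*} [NormedAddCommGroup X] [NormedSpace ℝ X] [CompleteSpace X]
    [NormedAddCommGroup Y] [NormedSpace ℝ Y] [CompleteSpace Y] (L : X →L[ℝ] Y) {T α t : ℝ}
    {u : ℝ → X} (h : RightRLExists T α u t) :
    rightRL T α (fun τ => L (u τ)) t = L (rightRL T α u t) := by
  unfold rightRL
  split_ifs with h0
  · rfl
  · have hi := h.resolve_left h0
    rw [map_smul, ← L.integral_comp_comm hi]
    simp only [map_smul]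

theorem RightRLExists.clm {X Y : Type*} [NormedAddCommGroup X] [NormedSpace ℝ X]
    [NormedAddCommGroup Y] [NormedSpace ℝ Y] (L : X →L[ℝ] Y) {T α t : ℝ}
    {u : ℝ → X} (h : RightRLExists T α u t) : RightRLExists T α (fun τ => L (u τ)) t := by
  refine h.imp id fun hi => ?_
  have := L.integrable_comp hi
  simp only [map_smul] at this
  exact this

/-- For order at most 1 the factor (τ - t)^(1-α), which cancels the kernel, is bounded on (t,T). -/
theorem RightRLExists.integrableOn {X : Type*} [NormedAddCommGroup X] [NormedSpace ℝ X]
    {T α t : ℝ} {u : ℝ → X} (h0 : α ≠ 0) (h1 : α ≤ 1) (h : RightRLExists T α u t) :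
    IntegrableOn u (Ioo t T) := by
  have hi := h.resolve_left h0
  have hb : IntegrableOn (fun τ => (τ - t) ^ (1 - α) • ((τ - t) ^ (α - 1) • u τ)) (Ioo t T) := by
    refine Integrable.bdd_smul (𝕜 := ℝ) (C := (T - t) ^ (1 - α)) hi ?_ ?_
    · exact (by fun_prop : Measurable fun τ : ℝ => (τ - t) ^ (1 - α)).aestronglyMeasurable
    · filter_upwards [ae_restrict_mem measurableSet_Ioo] with τ hτ
      have : 0 ≤ τ - t := by linarith [hτ.1]
      rw [Real.norm_of_nonneg (Real.rpow_nonneg this _)]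
      exact Real.rpow_le_rpow this (by linarith [hτ.2]) (by linarith)
  refine hb.congr_fun (fun τ hτ => ?_) measurableSet_Ioo
  have : 0 < τ - t := by linarith [hτ.1]
  simp only [smul_smul]
  rw [← Real.rpow_add this]
  simp

/-- The kernel `x ↦ Γ(α)⁻¹ (-x)^(α-1) e^(p x)` on the negative half-line. -/
noncomputable def lapKernel (p α : ℝ) : ℝ → ℝ :=
  indicator (Iio 0) fun x => (Real.Gamma α)⁻¹ * ((-x) ^ (α - 1) * Real.exp (-(p * -x)))

theorem integrableOn_rpow_exp_Iio {p α : ℝ} (hα : 0 < α) (hp : 0 < p) :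
    IntegrableOn (fun x : ℝ => (-x) ^ (α - 1) * Real.exp (-(p * -x))) (Iio 0) := by
  have h : IntegrableOn (fun x : ℝ => x ^ (α - 1) * Real.exp (-(p * x))) (Ioi (-0)) := by
    have := integrableOn_rpow_mul_exp_neg_mul_rpow (s := α - 1) (p := 1) (b := p)
      (by linarith) one_pos hp
    simpa using this
  exact h.comp_neg_Iio

theorem integral_rpow_exp_Iio {p α : ℝ} (hα : 0 < α) (hp : 0 < p) :
    ∫ x in Iio (0 : ℝ), (-x) ^ (α - 1) * Real.exp (-(p * -x)) = p ^ (-α) * Real.Gamma α := by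
  have := integral_comp_neg_Iic (0 : ℝ) fun x : ℝ => x ^ (α - 1) * Real.exp (-(p * x))
  rw [← integral_Iic_eq_integral_Iio, this, neg_zero, Real.integral_rpow_mul_exp_neg_mul_Ioi hα hp, one_div,
    Real.inv_rpow hp.le, Real.rpow_neg hp.le]

theorem integrable_lapKernel {p α : ℝ} (hα : 0 < α) (hp : 0 < p) :
    Integrable (lapKernel p α) :=
  IntegrableOn.integrable_indicator ((integrableOn_rpow_exp_Iio hα hp).const_mul _)
    measurableSet_Iio

theorem integral_lapKernel {p α : ℝ} (hα : 0 < α) (hp : 0 < p) :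
    ∫ x, lapKernel p α x = p ^ (-α) := by
  rw [lapKernel, integral_indicator measurableSet_Iio, integral_const_mul,
    integral_rpow_exp_Iio hα hp]
  field_simp [(Real.Gamma_pos_of_pos hα).ne']

/-- The Laplace transform over `(0,T)` (in the reversed time `T - t`) of a right fractional
integral differs from the product of the transforms by a term of order `e^(-pT)`. -/
theorem laplace_rightRL {T p α : ℝ} (hT : 0 < T) (hp : 0 < p) (hα0 : 0 ≤ α) (hα1 : α ≤ 1)
    {g : ℝ → ℝ} (hg : IntegrableOn g (Ioo 0 T)) :
    IntegrableOn (fun t => Real.exp (-(p * (T - t))) * rightRL T α g t) (Ioo 0 T) ∧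
    |(∫ t in Ioo 0 T, Real.exp (-(p * (T - t))) * rightRL T α g t)
      - p ^ (-α) * ∫ t in Ioo 0 T, Real.exp (-(p * (T - t))) * g t|
      ≤ p ^ (-α) * Real.exp (-(p * T)) * ∫ t in Ioo 0 T, |g t| := by
  have hwi : IntegrableOn (fun t => Real.exp (-(p * (T - t))) * g t) (Ioo 0 T) := by
    refine Integrable.bdd_mul (c := 1) hg ?_ ?_
    · exact (by fun_prop : Measurable fun t : ℝ => Real.exp (-(p * (T - t)))).aestronglyMeasurable
    · filter_upwards [ae_restrict_mem measurableSet_Ioo] with τ hτ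
      rw [Real.norm_of_nonneg (Real.exp_pos _).le, Real.exp_le_one_iff]
      have : 0 ≤ p * (T - τ) := mul_nonneg hp.le (by linarith [hτ.2])
      linarith
  have hgn : 0 ≤ ∫ t in Ioo 0 T, |g t| := integral_nonneg fun _ => abs_nonneg _
  rcases hα0.eq_or_lt with rfl | hα
  · simp only [rightRL, if_true, neg_zero, Real.rpow_zero, one_mul, sub_self, abs_zero]
    exact ⟨hwi, mul_nonneg (Real.exp_pos _).le hgn⟩
  have hΓ := Real.Gamma_pos_of_pos hα
  -- On the whole line the weighted fractional integral is the convolution of the truncated weighted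
  -- g with `lapKernel`, and its total integral is the product of the two integrals. On (0,T) it is
  -- the wanted integrand, beyond T it is zero, and the half-line t < 0 is the error.
  set G : ℝ → ℝ := indicator (Ioo 0 T) fun t => Real.exp (-(p * (T - t))) * g t with hG
  have hGi : Integrable G := hwi.integrable_indicator measurableSet_Ioo
  set c : ℝ → ℝ := convolution G (lapKernel p α) (ContinuousLinearMap.mul ℝ ℝ) volume with hc
  have hci : Integrable c := hGi.integrable_convolution _ (integrable_lapKernel hα hp)
  have hcint : ∫ t, c t = p ^ (-α) * ∫ t in Ioo 0 T, Real.exp (-(p * (T - t))) * g t := by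
    rw [hc, integral_convolution _ hGi (integrable_lapKernel hα hp), integral_lapKernel hα hp,
      hG, integral_indicator measurableSet_Ioo, ContinuousLinearMap.mul_apply', mul_comm]
  have hcx : ∀ t, c t = ∫ y, G y * lapKernel p α (t - y) := fun t => rfl
  have hcgen : ∀ t, c t = ∫ y in Ioo (max 0 t) T,
      (Real.Gamma α)⁻¹ * Real.exp (-(p * (T - t))) * ((y - t) ^ (α - 1) * g y) := by
    intro t
    rw [hcx, ← integral_indicator measurableSet_Ioo]
    congr 1
    funext y
    by_cases h1 : y ∈ Ioo 0 T
    · by_cases h2 : t < y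
      · rw [indicator_of_mem (mem_Ioo.mpr ⟨max_lt h1.1 h2, h1.2⟩), hG,
          indicator_of_mem h1, lapKernel, indicator_of_mem (by simpa using h2 : t - y ∈ Iio 0)]
        have : Real.exp (-(p * (T - t)))
            = Real.exp (-(p * (T - y))) * Real.exp (-(p * -(t - y))) := by
          rw [← Real.exp_add]; congr 1; ring
        rw [this, neg_sub]; ring
      · rw [lapKernel, indicator_of_notMem (by simpa using h2 : t - y ∉ Iio 0), mul_zero,
          indicator_of_notMem]
        exact fun h => h2 ((le_max_right _ _).trans_lt h.1)
    · rw [hG, indicator_of_notMem h1, zero_mul, indicator_of_notMem]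
      exact fun h => h1 ⟨(le_max_left _ _).trans_lt h.1, h.2⟩
  have hc1 : ∀ t ∈ Ioo 0 T, c t = Real.exp (-(p * (T - t))) * rightRL T α g t := by
    intro t ht
    rw [hcgen, max_eq_right ht.1.le, integral_const_mul, rightRL, if_neg hα.ne']
    simp only [smul_eq_mul]; ring
  have hc2 : ∀ t ∈ Ici T, c t = 0 := by
    intro t ht
    rw [hcgen, Ioo_eq_empty (not_lt.mpr ((mem_Ici.mp ht).trans (le_max_right _ _))), Measure.restrict_empty,
      integral_zero_measure]
  -- The factor e^(-pT) comes from T - t = T + (-t). As α ≤ 1, the kernel (y - t)^(α-1) is largest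
  -- at y = 0, which decouples it from g.
  have hc3 : ∀ t ∈ Iio 0, ‖c t‖ ≤ (Real.Gamma α)⁻¹ * (∫ t in Ioo 0 T, |g t|) *
      Real.exp (-(p * T)) * ((-t) ^ (α - 1) * Real.exp (-(p * -t))) := by
    intro t ht
    have ht : t < 0 := ht
    rw [hcgen, max_eq_left ht.le]
    have he : Real.exp (-(p * (T - t))) = Real.exp (-(p * T)) * Real.exp (-(p * -t)) := by
      rw [← Real.exp_add]; congr 1; ring
    calc _ ≤ ∫ y in Ioo 0 T, (Real.Gamma α)⁻¹ * Real.exp (-(p * (T - t))) *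
            (-t) ^ (α - 1) * |g y| := by
          refine norm_integral_le_of_norm_le (hg.abs.const_mul _) ?_
          filter_upwards [ae_restrict_mem measurableSet_Ioo] with y hy
          have h0 : 0 < y - t := by linarith [hy.1]
          rw [norm_mul, norm_mul (_ ^ _),
            Real.norm_of_nonneg (mul_nonneg (inv_nonneg.mpr hΓ.le) (Real.exp_pos _).le),
            Real.norm_of_nonneg (Real.rpow_nonneg h0.le _), Real.norm_eq_abs, ← mul_assoc]
          have h1 : (y - t) ^ (α - 1) ≤ (-t) ^ (α - 1) :=
            Real.rpow_le_rpow_of_nonpos (by linarith) (by linarith [hy.1]) (by linarith)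
          gcongr
      _ = _ := by rw [integral_const_mul, he]; ring
  refine ⟨(hci.integrableOn (s := Ioo 0 T)).congr_fun hc1 measurableSet_Ioo, ?_⟩
  have hsplit : ∫ t, c t = (∫ t in Iio 0, c t) + ∫ t in Ioo 0 T, c t := by
    have e1 := intervalIntegral.integral_Iio_add_Ici (b := (0 : ℝ)) (f := c) (μ := volume)
      hci.integrableOn hci.integrableOn
    have e2 := setIntegral_union (μ := volume) (f := c) (s := Ico 0 T) (t := Ici T)
      (Set.disjoint_left.mpr fun x hx hx' => absurd hx.2 (not_lt.mpr hx')) measurableSet_Ici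
      hci.integrableOn hci.integrableOn
    rw [Ico_union_Ici_eq_Ici hT.le, setIntegral_eq_zero_of_forall_eq_zero hc2, add_zero,
      integral_Ico_eq_integral_Ioo] at e2
    rw [← e1, e2]
  rw [← hcint, ← setIntegral_congr_fun measurableSet_Ioo hc1, hsplit, sub_add_cancel_right,
    abs_neg]
  calc |∫ t in Iio 0, c t| ≤ ∫ t in Iio 0, (Real.Gamma α)⁻¹ * (∫ t in Ioo 0 T, |g t|) *
      Real.exp (-(p * T)) * ((-t) ^ (α - 1) * Real.exp (-(p * -t))) :=
        norm_integral_le_of_norm_le ((integrableOn_rpow_exp_Iio hα hp).const_mul _)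
          ((ae_restrict_mem measurableSet_Iio).mono fun t ht => hc3 t ht)
    _ = _ := by
      rw [integral_const_mul, integral_rpow_exp_Iio hα hp]
      field_simp

/-- A function whose exponential moments `∫₀ᵀ e^(nt) g(t) dt` grow at most linearly in `n` has
vanishing integrals. -/
theorem integral_eq_zero_of_exp_moments {T C : ℝ} {g : ℝ → ℝ} (hg : IntegrableOn g (Ioo 0 T))
    (hC : ∀ n : ℕ, 1 ≤ n → |∫ t in Ioo 0 T, Real.exp (n * t) * g t| ≤ C * n)
    {s : ℝ} (hs : s ∈ Ioo 0 T) : ∫ t in Ioo s T, g t = 0 := by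
  have hC0 : 0 ≤ C := by simpa using (abs_nonneg _).trans (hC 1 le_rfl)
  -- A bounded double-exponential cutoff that tends to the indicator of (s,T). Its power series
  -- involves only the exponentials e^(n(k+1)t), so the moment bounds apply term by term.
  set Ψ : ℕ → ℝ → ℝ := fun n t => 1 - Real.exp (-Real.exp (n * (t - s))) with hΨ
  have hlim : Tendsto (fun n => ∫ t in Ioo 0 T, Ψ n t * g t) atTop
      (𝓝 (∫ t in Ioo 0 T, indicator (Ioo s T) g t)) := by
    refine tendsto_integral_of_dominated_convergence (fun t => |g t|) ?_ hg.abs ?_ ?_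
    · intro n
      exact ((by fun_prop : Measurable (Ψ n)).aestronglyMeasurable).mul hg.aestronglyMeasurable
    · intro n
      refine ae_of_all _ fun t => ?_
      rw [norm_mul, Real.norm_eq_abs, Real.norm_eq_abs]
      refine mul_le_of_le_one_left (abs_nonneg _) ?_
      have h1 := Real.exp_pos (-Real.exp (n * (t - s)))
      have h2 : Real.exp (-Real.exp (n * (t - s))) ≤ 1 :=
        Real.exp_le_one_iff.mpr (neg_nonpos.mpr (Real.exp_pos _).le)
      rw [abs_le]; constructor <;> simp only [hΨ] <;> linarith
    · have hne : ∀ᵐ t ∂(volume.restrict (Ioo 0 T)), t ≠ s :=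
        ae_restrict_of_ae (Measure.ae_ne volume s)
      filter_upwards [hne, ae_restrict_mem measurableSet_Ioo] with t hts ht
      rcases lt_or_gt_of_ne hts with h | h
      · rw [indicator_of_notMem (fun h' => absurd h'.1 (not_lt.mpr h.le))]
        have h1 : Tendsto (fun n : ℕ => (n : ℝ) * (t - s)) atTop atBot :=
          tendsto_natCast_atTop_atTop.atTop_mul_const_of_neg (by linarith)
        have h2 := (Real.continuous_exp.tendsto _).comp (Real.tendsto_exp_atBot.comp h1).neg
        have h3 := (h2.const_sub 1).mul_const (g t)
        simpa using h3
      · rw [indicator_of_mem (mem_Ioo.mpr ⟨h, ht.2⟩)]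
        have h1 : Tendsto (fun n : ℕ => (n : ℝ) * (t - s)) atTop atTop :=
          tendsto_natCast_atTop_atTop.atTop_mul_const (by linarith)
        have h2 := Real.tendsto_exp_neg_atTop_nhds_zero.comp (Real.tendsto_exp_atTop.comp h1)
        have h3 := (h2.const_sub 1).mul_const (g t)
        simpa using h3
  have hbd : ∀ n : ℕ, 1 ≤ n → |∫ t in Ioo 0 T, Ψ n t * g t|
      ≤ C * Real.exp 1 * (n * Real.exp (-(s * n))) := by
    intro n hn
    set F : ℕ → ℝ → ℝ := fun k t =>
      -((-Real.exp (n * (t - s))) ^ (k + 1) / ((k + 1).factorial : ℝ)) * g t with hF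
    have hFe : ∀ k t, F k t = -((-1) ^ (k + 1) * Real.exp (-(n * s)) ^ (k + 1)
        / ((k + 1).factorial : ℝ)) * (Real.exp (((n * (k + 1) : ℕ) : ℝ) * t) * g t) := by
      intro k t
      have : Real.exp (((n * (k + 1) : ℕ) : ℝ) * t) = Real.exp (n * t) ^ (k + 1) := by
        rw [← Real.exp_nat_mul]; congr 1; push_cast; ring
      simp only [hF]
      rw [this, neg_pow, show (n : ℝ) * (t - s) = -(n * s) + n * t by ring, Real.exp_add, mul_pow]
      ring
    have hsum : ∀ t, HasSum (fun k => F k t) (Ψ n t * g t) := by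
      intro t
      have h0 := NormedSpace.expSeries_div_hasSum_exp (𝔸 := ℝ) (-Real.exp (n * (t - s)))
      rw [← Real.exp_eq_exp_ℝ] at h0
      have h1 := ((hasSum_nat_add_iff' 1).mpr h0).neg.mul_right (g t)
      simpa [hΨ, hF] using h1
    have hFsum := hasSum_integral_of_dominated_convergence (μ := volume.restrict (Ioo 0 T))
      (F := F) (f := fun t => Ψ n t * g t)
      (fun k t => Real.exp (n * T) ^ (k + 1) / ((k + 1).factorial : ℝ) * |g t|)
      ?_ ?_ ?_ ?_ (ae_of_all _ hsum)
    · rw [← hFsum.tsum_eq, ← Real.norm_eq_abs]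
      -- The moment bound C n (k+1) cancels the factor k+1 of (k+1)!, which leaves the exponential
      -- series in e^(-ns); the prefactor n e^(-ns) tends to 0.
      have hsm : HasSum (fun k : ℕ => C * n * Real.exp (-(n * s)) *
          (Real.exp (-(n * s)) ^ k / (k.factorial : ℝ)))
          (C * n * Real.exp (-(n * s)) * Real.exp (Real.exp (-(n * s)))) := by
        have h0 := NormedSpace.expSeries_div_hasSum_exp (𝔸 := ℝ) (Real.exp (-(n * s)))
        rw [← Real.exp_eq_exp_ℝ] at h0
        exact h0.mul_left _
      refine (tsum_of_norm_bounded hsm fun k => ?_).trans ?_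
      · simp only [hFe]
        rw [integral_const_mul, norm_mul, norm_neg, norm_div, norm_mul, norm_pow, norm_neg,
          norm_one, one_pow, one_mul, norm_pow, Real.norm_of_nonneg (Real.exp_pos _).le,
          Real.norm_natCast, Nat.factorial_succ]
        have h1 := hC (n * (k + 1)) (Nat.mul_pos hn k.succ_pos)
        have hk : (0 : ℝ) < k.factorial := by exact_mod_cast k.factorial_pos
        rw [Real.norm_eq_abs]
        calc _ ≤ Real.exp (-(n * s)) ^ (k + 1) / (((k + 1) * k.factorial : ℕ) : ℝ) *
              (C * ((n * (k + 1) : ℕ) : ℝ)) := by gcongr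
          _ = _ := by push_cast; field_simp; ring
      · have : Real.exp (Real.exp (-(n * s))) ≤ Real.exp 1 := by
          apply Real.exp_le_exp.mpr
          rw [Real.exp_le_one_iff]
          have := hs.1
          have : (0 : ℝ) ≤ n * s := by positivity
          linarith
        calc _ ≤ C * n * Real.exp (-(n * s)) * Real.exp 1 := by gcongr
          _ = _ := by rw [mul_comm s]; ring
    · intro k
      exact ((by fun_prop : Measurable fun t : ℝ =>
        -((-Real.exp (n * (t - s))) ^ (k + 1) / ((k + 1).factorial : ℝ))).aestronglyMeasurable).mul
          hg.aestronglyMeasurable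
    · intro k
      filter_upwards [ae_restrict_mem measurableSet_Ioo] with t ht
      simp only [hF]
      rw [norm_mul, norm_neg, norm_div, norm_pow, norm_neg, Real.norm_of_nonneg (Real.exp_pos _).le,
        Real.norm_natCast, Real.norm_eq_abs]
      gcongr
      linarith [ht.2, hs.1]
    · refine ae_of_all _ fun t => Summable.mul_right _ ?_
      exact (summable_nat_add_iff 1).mpr (Real.summable_pow_div_factorial (Real.exp (n * T)))
    · have : (fun t => ∑' k : ℕ, Real.exp (n * T) ^ (k + 1) / ((k + 1).factorial : ℝ) * |g t|)
          = fun t => (∑' k : ℕ, Real.exp (n * T) ^ (k + 1) / ((k + 1).factorial : ℝ)) * |g t| := by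
        funext t; rw [tsum_mul_right]
      rw [this]
      exact hg.abs.const_mul _
  have h0 : Tendsto (fun n : ℕ => C * Real.exp 1 * (n * Real.exp (-(s * n)))) atTop (𝓝 0) := by
    have h1 := (tendsto_rpow_mul_exp_neg_mul_atTop_nhds_zero 1 s hs.1).comp
      tendsto_natCast_atTop_atTop
    have h2 := (h1.const_mul (C * Real.exp 1))
    simpa [Function.comp_def] using h2
  have hz := tendsto_nhds_unique hlim
    (squeeze_zero_norm' (eventually_atTop.mpr ⟨1, fun n hn => hbd n hn⟩) h0)
  rwa [integral_indicator measurableSet_Ioo, Measure.restrict_restrict measurableSet_Ioo,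
    inter_eq_left.mpr (Ioo_subset_Ioo_left hs.1.le)] at hz

/-! ### The resolvent of the operator and its spectral decomposition -/

namespace EllipticOperator

variable {H : Type*} [NormedAddCommGroup H] [InnerProductSpace ℝ H] [CompleteSpace H]

/-- The resolvent `(1 + A)⁻¹`. -/
noncomputable def resolvent (A : EllipticOperator H) : H →L[ℝ] H :=
  A.toH ∘L ContinuousLinearMap.adjoint A.toH

theorem resolvent_apply (A : EllipticOperator H) (h : H) :
    A.resolvent h = A.toH (ContinuousLinearMap.adjoint A.toH h) := rfl

theorem inner_resolvent (A : EllipticOperator H) (x y : H) :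
    ⟪A.resolvent x, y⟫_ℝ = ⟪x, A.resolvent y⟫_ℝ := by
  rw [resolvent_apply, resolvent_apply, ← ContinuousLinearMap.adjoint_inner_right,
    ContinuousLinearMap.adjoint_inner_left]

theorem inner_resolvent_self_nonneg (A : EllipticOperator H) (x : H) :
    0 ≤ ⟪A.resolvent x, x⟫_ℝ := by
  rw [resolvent_apply, ← ContinuousLinearMap.adjoint_inner_right]
  exact real_inner_self_nonneg

/-- The adjoint of `toH` is the Riesz solution operator of the form. Testing with y ∈ D(A) shows
that the resolvent lands in the domain of the adjoint of A, which is A itself. -/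
theorem exists_resolvent_eq (A : EllipticOperator H) (h : H) :
    ∃ x : A.op.domain, (x : H) = A.resolvent h ∧ A.op x + (x : H) = h := by
  have key : ∀ y : A.op.domain,
      ⟪h - A.resolvent h, (y : H)⟫_ℝ = ⟪A.resolvent h, A.op y⟫_ℝ := by
    intro y
    have h1 := A.form_coe_left (show A.FormCore from y) (ContinuousLinearMap.adjoint A.toH h)
    rw [form, ContinuousLinearMap.adjoint_inner_right, toH_coe, ← resolvent_apply] at h1
    have h2 : ⟪(y : H), h⟫_ℝ - ⟪(y : H), A.resolvent h⟫_ℝ = ⟪A.op y, A.resolvent h⟫_ℝ := h1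
    rw [inner_sub_left, real_inner_comm, real_inner_comm (y : H) (A.resolvent h),
      real_inner_comm (A.op y), h2]
  have hmem := LinearPMap.mem_adjoint_domain_of_exists (T := A.op) (A.resolvent h) ⟨_, key⟩
  have happ := LinearPMap.adjoint_apply_eq A.selfAdjoint.dense_domain ⟨_, hmem⟩ key
  have hle := (LinearPMap.isSelfAdjoint_def.mp A.selfAdjoint).le
  refine ⟨⟨_, hle.1 hmem⟩, rfl, ?_⟩
  rw [← hle.2 (x := ⟨_, hmem⟩) (y := ⟨_, hle.1 hmem⟩) rfl, happ, sub_add_cancel]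

/-- A priori bounds for the resolvent equation. -/
theorem norm_le_of_resolvent_eq (A : EllipticOperator H) {q : ℝ} (hq : 1 ≤ q)
    {x : A.op.domain} {h : H} (hx : A.op x + q • (x : H) = h) :
    ‖(x : H)‖ ≤ ‖h‖ ∧ ‖A.op x‖ ≤ ‖h‖ := by
  have h1 : ‖h‖ ^ 2 = ‖A.op x‖ ^ 2 + 2 * (q * ⟪A.op x, (x : H)⟫_ℝ) + q ^ 2 * ‖(x : H)‖ ^ 2 := by
    rw [← hx, norm_add_sq_real, real_inner_smul_right, norm_smul, mul_pow, Real.norm_eq_abs,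
      sq_abs]
  have h2 : 0 ≤ q * ⟪A.op x, (x : H)⟫_ℝ := mul_nonneg (by linarith) (A.nonneg x)
  have h3 : ‖(x : H)‖ ^ 2 ≤ q ^ 2 * ‖(x : H)‖ ^ 2 :=
    le_mul_of_one_le_left (sq_nonneg _) (one_le_pow₀ hq)
  have h4 := sq_nonneg ‖(x : H)‖
  have h5 := sq_nonneg ‖A.op x‖
  exact ⟨le_of_sq_le_sq (by linarith) (norm_nonneg _),
    le_of_sq_le_sq (by linarith) (norm_nonneg _)⟩

theorem resolvent_op_add (A : EllipticOperator H) (x : A.op.domain) :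
    A.resolvent (A.op x + (x : H)) = x := by
  obtain ⟨y, hy, hy'⟩ := A.exists_resolvent_eq (A.op x + (x : H))
  have h0 : A.op (y - x) + (1 : ℝ) • ((y - x : A.op.domain) : H) = 0 := by
    rw [LinearPMap.map_sub, one_smul, Submodule.coe_sub]
    rw [← sub_eq_zero] at hy'
    rw [← hy']; abel
  have := (A.norm_le_of_resolvent_eq le_rfl h0).1
  rw [norm_zero, norm_le_zero_iff, Submodule.coe_sub, sub_eq_zero] at this
  rw [← hy, this]

theorem resolvent_injective (A : EllipticOperator H) {h : H} (h0 : A.resolvent h = 0) : h = 0 := by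
  obtain ⟨x, hx, hx'⟩ := A.exists_resolvent_eq h
  have : x = 0 := Subtype.ext (hx.trans h0)
  rw [← hx', this]; simp

/-- The map h ↦ (Rh, h - Rh) factors the resolvent R through the graph of A, where the projection to
H is compact. -/
theorem isCompactOperator_resolvent (A : EllipticOperator H) : IsCompactOperator A.resolvent := by
  let L : H →L[ℝ] A.op.graph := (A.resolvent.prod (ContinuousLinearMap.id ℝ H - A.resolvent)).codRestrict
    A.op.graph (by
      intro h
      obtain ⟨x, hx, hx'⟩ := A.exists_resolvent_eq h
      rw [LinearPMap.mem_graph_iff]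
      refine ⟨x, hx, ?_⟩
      change A.op x = h - A.resolvent h
      rw [← hx, eq_sub_iff_add_eq, hx'])
  exact A.compact.comp_clm L

/-- The resolvent equation `A x + q x = h` is solvable for `q ≥ 1`. -/
theorem exists_op_add_smul_eq (A : EllipticOperator H) {q : ℝ} (hq : 1 ≤ q) (h : H) :
    ∃ x : A.op.domain, A.op x + q • (x : H) = h := by
  -- With x = Rz, where R is the resolvent, the equation becomes z + (q-1) R z = h, and 1 + (q-1) R
  -- is coercive since R ≥ 0.
  have hu : IsUnit (ContinuousLinearMap.id ℝ H + (q - 1) • A.resolvent) := by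
    refine ContinuousLinearMap.isUnit_of_forall_le_norm_inner_map _ (c := 1) one_pos fun x => ?_
    have h1 : ⟪(ContinuousLinearMap.id ℝ H + (q - 1) • A.resolvent) x, x⟫_ℝ
        = ‖x‖ ^ 2 + (q - 1) * ⟪A.resolvent x, x⟫_ℝ := by
      simp [inner_add_left, real_inner_smul_left]
    have h2 := mul_nonneg (sub_nonneg.mpr hq) (A.inner_resolvent_self_nonneg x)
    rw [h1, NNReal.coe_one, mul_one, Real.norm_eq_abs]
    exact (le_abs_self _).trans' (by linarith)
  obtain ⟨z, hz⟩ := (ContinuousLinearMap.isUnit_iff_bijective.mp hu).2 h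
  obtain ⟨x, hx, hx'⟩ := A.exists_resolvent_eq z
  refine ⟨x, ?_⟩
  rw [← hz]
  change _ = z + (q - 1) • A.resolvent z
  rw [← hx, ← hx', sub_smul, one_smul]; abel

/-- The eigenvalue of A is s⁻¹ - 1: non-negative because A is, and nonzero because A has trivial
kernel. -/
theorem eigen_resolvent (A : EllipticOperator H) {s : ℝ} {e : H} (he : A.resolvent e = s • e)
    (h0 : e ≠ 0) : ∃ l : ℝ, 0 < l ∧ ∃ y : A.op.domain, (y : H) = e ∧ A.op y = l • e := by
  have hs : s ≠ 0 := by
    rintro rfl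
    exact h0 (A.resolvent_injective (by rw [he, zero_smul]))
  obtain ⟨x, hx, hx'⟩ := A.exists_resolvent_eq e
  have hy : ((s⁻¹ • x : A.op.domain) : H) = e := by
    rw [Submodule.coe_smul, hx, he, smul_smul, inv_mul_cancel₀ hs, one_smul]
  have hAy : A.op (s⁻¹ • x) = (s⁻¹ - 1) • e := by
    rw [LinearPMap.map_smul, eq_sub_iff_add_eq.mpr hx', hx, he, smul_sub, smul_smul,
      inv_mul_cancel₀ hs, sub_smul]
  have hpos : 0 < ‖e‖ ^ 2 := by positivity
  have hnn := A.nonneg (s⁻¹ • x)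
  rw [hAy, hy, real_inner_smul_left, real_inner_self_eq_norm_sq] at hnn
  refine ⟨s⁻¹ - 1, (nonneg_of_mul_nonneg_left hnn hpos).lt_of_ne' fun h => h0 ?_, _, hy, hAy⟩
  have := A.ker_eq_zero (s⁻¹ • x) (by rw [hAy, h, zero_smul])
  rw [← hy, this]; rfl

/-- Every vector is the unconditional sum of eigenvectors to positive eigenvalues. -/
theorem exists_hasSum_eigenvectors (A : EllipticOperator H) (v : H) :
    ∃ (u : ℝ → H) (l : ℝ → ℝ), HasSum u v ∧
      ∀ i, 0 < l i ∧ ∃ y : A.op.domain, (y : H) = u i ∧ A.op y = l i • u i := by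
  have hsym : (A.resolvent : H →ₗ[ℝ] H).IsSymmetric := A.inner_resolvent
  have hcl : ∀ s : ℝ, CompleteSpace (Module.End.eigenspace (A.resolvent : H →ₗ[ℝ] H) s) := by
    intro s
    have : IsClosed (Module.End.eigenspace (A.resolvent : H →ₗ[ℝ] H) s : Set H) := by
      have : (Module.End.eigenspace (A.resolvent : H →ₗ[ℝ] H) s : Set H)
          = {x | A.resolvent x = s • x} := by
        ext x; simp
      rw [this]
      exact isClosed_eq (by fun_prop) (by fun_prop)
    exact this.completeSpace_coe
  have hHS := IsHilbertSum.mkInternal _ hsym.orthogonalFamily_eigenspaces (by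
    rw [top_le_iff, Submodule.topologicalClosure_eq_top_iff]
    exact ContinuousLinearMap.orthogonalComplement_iSup_eigenspaces_eq_bot
      A.isCompactOperator_resolvent hsym)
  have hs := hHS.hasSum_linearIsometryEquiv_symm (hHS.linearIsometryEquiv v)
  rw [LinearIsometryEquiv.symm_apply_apply] at hs
  set w := hHS.linearIsometryEquiv v
  have hex : ∀ i : ℝ, ∃ l : ℝ, 0 < l ∧
      ∃ y : A.op.domain, (y : H) = (w i : H) ∧ A.op y = l • (w i : H) := by
    intro i
    -- A zero component gets the arbitrary eigenvalue 1, so that all `l i` are positive.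
    by_cases h0 : (w i : H) = 0
    · exact ⟨1, one_pos, 0, by simp [h0]⟩
    · exact A.eigen_resolvent (Module.End.mem_eigenspace_iff.mp (w i).2) h0
  choose l hl using hex
  exact ⟨fun i => w i, l, hs, hl⟩

/-- If a vector is orthogonal to all resolvents of a set of test vectors, and the only eigenvector
orthogonal to the test vectors is zero, then it is zero. -/
theorem eq_zero_of_resolvents_orthogonal (A : EllipticOperator H) (K : Set H)
    (hucp : ∀ l : ℝ, 0 < l → ∀ e : A.op.domain, A.op e = l • (e : H) →
      (∀ h ∈ K, ⟪(e : H), h⟫_ℝ = 0) → (e : H) = 0)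
    {v₀ : H} (hv : ∀ h ∈ K, ∀ q : ℝ, 1 ≤ q → ∀ x : A.op.domain, A.op x + q • (x : H) = h →
      ⟪v₀, (x : H)⟫_ℝ = 0) : v₀ = 0 := by
  let R : Set H := {z | ∃ h ∈ K, ∃ q : ℝ, 1 ≤ q ∧ ∃ x : A.op.domain,
    A.op x + q • (x : H) = h ∧ (x : H) = z}
  let M : Submodule ℝ H := (Submodule.span ℝ R)ᗮ
  have hM : ∀ u : H, u ∈ M ↔ ∀ z ∈ R, ⟪u, z⟫_ℝ = 0 := by
    intro u
    rw [Submodule.mem_orthogonal']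
    refine ⟨fun h z hz => h z (Submodule.subset_span hz), fun h z hz => ?_⟩
    induction hz using Submodule.span_induction with
    | mem z hz => exact h z hz
    | zero => exact inner_zero_right _
    | add a b _ _ ha hb => rw [inner_add_right, ha, hb, add_zero]
    | smul c a _ ha => rw [real_inner_smul_right, ha, mul_zero]
  have hrel : ∀ (q : ℝ) (x : A.op.domain) (h : H), A.op x + q • (x : H) = h →
      (x : H) + (q - 1) • A.resolvent x = A.resolvent h := by
    intro q x h hx
    have : h = (A.op x + (x : H)) + (q - 1) • (x : H) := by
      rw [← hx, sub_smul, one_smul]; abel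
    rw [this, map_add, map_smul, resolvent_op_add]
  have hres : ∀ h ∈ K, A.resolvent h ∈ R := by
    intro h hh
    obtain ⟨x, hx, hx'⟩ := A.exists_resolvent_eq h
    exact ⟨h, hh, 1, le_rfl, x, by rwa [one_smul], hx⟩
  -- Resolvent identity: (q-1) R x = R h - x is a difference of two elements of `R`, and q ≠ 1
  -- allows division.
  have hgt : ∀ u ∈ M, ∀ h ∈ K, ∀ q : ℝ, 1 < q → ∀ x : A.op.domain,
      A.op x + q • (x : H) = h → ⟪u, A.resolvent x⟫_ℝ = 0 := by
    intro u hu h hh q hq x hx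
    have h1 := congrArg (fun z => ⟪u, z⟫_ℝ) (hrel q x h hx)
    simp only [inner_add_right, real_inner_smul_right] at h1
    rw [(hM u).mp hu _ (hres h hh), (hM u).mp hu _ ⟨h, hh, q, hq.le, x, hx, rfl⟩, zero_add] at h1
    exact (mul_eq_zero.mp h1).resolve_left (by linarith)
  have hinv : ∀ u ∈ M, (A.resolvent : H →ₗ[ℝ] H) u ∈ M := by
    intro u hu
    rw [hM]
    rintro z ⟨h, hh, q, hq, x, hx, rfl⟩
    rw [ContinuousLinearMap.coe_coe, inner_resolvent]
    rcases hq.eq_or_lt with rfl | hq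
    -- At q = 1 there is nothing to divide by. Perturbing q to 1 + ε gives x = y + ε A.resolvent y
    -- with y covered by `hgt`, and ε tends to 0.
    · have hb : ∀ ε : ℝ, 0 < ε → |⟪u, A.resolvent x⟫_ℝ| ≤
          ε * (‖u‖ * (‖A.resolvent‖ * (‖A.resolvent‖ * ‖h‖))) := by
        intro ε hε
        obtain ⟨y, hy⟩ := A.exists_op_add_smul_eq (q := 1 + ε) (by linarith) h
        have hyn := (A.norm_le_of_resolvent_eq (by linarith) hy).1
        have h1 := hrel _ y h hy
        rw [← hrel 1 x h hx, sub_self, zero_smul, add_zero, add_sub_cancel_left] at h1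
        rw [← h1, map_add, map_smul, inner_add_right, hgt u hu h hh _ (by linarith) y hy, zero_add,
          real_inner_smul_right, abs_mul, abs_of_pos hε]
        gcongr
        refine (abs_real_inner_le_norm _ _).trans ?_
        gcongr
        refine (A.resolvent.le_opNorm _).trans ?_
        gcongr
        exact (A.resolvent.le_opNorm _).trans (by gcongr)
      have hlim : Tendsto (fun ε : ℝ => ε * (‖u‖ * (‖A.resolvent‖ * (‖A.resolvent‖ * ‖h‖))))
          (𝓝[>] 0) (𝓝 0) := by
        have : Tendsto (fun ε : ℝ => ε) (𝓝[>] 0) (𝓝 0) := tendsto_nhdsWithin_of_tendsto_nhds tendsto_id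
        simpa using this.mul_const (‖u‖ * (‖A.resolvent‖ * (‖A.resolvent‖ * ‖h‖)))
      have := ge_of_tendsto hlim (eventually_mem_nhdsWithin.mono fun ε hε => hb ε hε)
      exact abs_nonpos_iff.mp this
    · exact hgt u hu h hh q hq x hx
  have hsym : (A.resolvent : H →ₗ[ℝ] H).IsSymmetric := A.inner_resolvent
  let S : M →L[ℝ] M := A.resolvent.restrict hinv
  have hSc : IsCompactOperator S := A.isCompactOperator_resolvent.restrict' hinv
  have hSs : (S : M →ₗ[ℝ] M).IsSymmetric := hsym.restrict_invariant hinv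
  have hS0 : S = 0 := by
    rw [← ContinuousLinearMap.eq_zero_of_forall_hasEigenvalue_eq_zero hSc hSs]
    intro s hs
    obtain ⟨e, he, he0⟩ := hs.exists_hasEigenvector
    refine absurd ?_ he0
    have h1 : A.resolvent (e : H) = s • (e : H) :=
      congrArg Subtype.val (Module.End.mem_eigenspace_iff.mp he)
    by_contra h0
    have h0' : (e : H) ≠ 0 := fun h => h0 (Subtype.ext h)
    obtain ⟨l, hl, y, hy, hAy⟩ := A.eigen_resolvent h1 h0'
    refine h0' (hy ▸ hucp l hl y (by rw [hAy, hy]) fun h hh => ?_)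
    -- Writing h = A x + x gives (e, h) = (l + 1)(e, x) = 0, so e is orthogonal to K and must
    -- vanish. Hence `S` has no eigenvalues at all.
    obtain ⟨x, hx⟩ := A.exists_op_add_smul_eq le_rfl h
    have h2 := (hM e).mp e.2 _ ⟨h, hh, 1, le_rfl, x, hx, rfl⟩
    rw [← hy] at h2
    rw [← hx, inner_add_right, real_inner_smul_right, h2, ← A.symm, hAy, ← hy,
      real_inner_smul_left, h2]
    simp
  have hv₀ : v₀ ∈ M := by
    rw [hM]
    rintro z ⟨h, hh, q, hq, x, hx, rfl⟩
    exact hv h hh q hq x hx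
  refine A.resolvent_injective ?_
  have := congrArg Subtype.val (DFunLike.congr_fun hS0 ⟨v₀, hv₀⟩)
  exact this

/-- If the resolvent matrix element `(v₀, (q + A)⁻¹ h)` decays at least like `p² e^(-Tp)` for
`q = p^m`, where `m ≤ 1`, then it vanishes. -/
theorem inner_resolvent_eq_zero_of_decay (A : EllipticOperator H) {v₀ h : H} {C T m : ℝ}
    (hT : 0 < T) (hm0 : 0 < m) (hm1 : m ≤ 1)
    (hdec : ∀ p : ℝ, 1 ≤ p → ∀ x : A.op.domain, A.op x + (p ^ m) • (x : H) = h →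
      |⟪v₀, (x : H)⟫_ℝ| ≤ C * p ^ 2 * Real.exp (-(p * T)))
    {q : ℝ} (hq : 1 ≤ q) {x : A.op.domain} (hx : A.op x + q • (x : H) = h) :
    ⟪v₀, (x : H)⟫_ℝ = 0 := by
  obtain ⟨u, l, hu, hl⟩ := A.exists_hasSum_eigenvectors v₀
  set c : ℝ → ℝ := fun i => ⟪u i, h⟫_ℝ with hc
  have huy : ∀ y : H, HasSum (fun i => ⟪u i, y⟫_ℝ) ⟪v₀, y⟫_ℝ := fun y => by
    simpa only [innerSL_apply_apply, real_inner_comm] using (innerSL ℝ y).hasSum hu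
  have hcs : Summable fun i => |c i| :=
    (huy h).summable.abs
  -- The spectral expansion of (v₀, ((z+1)² + A)⁻¹ h). The shift by 1 puts the poles on Re z = -1
  -- and makes (t+1)² ≥ 1 for t ≥ 0, where the resolvent bounds hold; the square makes the decay
  -- Gaussian.
  set Φ : ℂ → ℂ := fun z => ∑' i, (c i : ℂ) / ((z + 1) ^ 2 + (l i : ℂ)) with hΦ
  set U : Set ℂ := {z | -(1 / 2) < z.re} with hU
  have hUo : IsOpen U := isOpen_lt continuous_const Complex.continuous_re
  have hden : ∀ i, ∀ z ∈ U, 1 / 4 ≤ ‖(z + 1) ^ 2 + (l i : ℂ)‖ := by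
    intro i z hz
    have hz : -(1 / 2) < z.re := hz
    have hfac : (z + 1) ^ 2 + (l i : ℂ)
        = (z + 1 + (√(l i) : ℝ) * Complex.I) * (z + 1 - (√(l i) : ℝ) * Complex.I) := by
      have h1 : ((√(l i) : ℝ) : ℂ) ^ 2 = l i := by
        rw [← Complex.ofReal_pow, Real.sq_sqrt (hl i).1.le]
      linear_combination (-1 : ℂ) * h1 + ((√(l i) : ℝ) : ℂ) ^ 2 * Complex.I_sq
    have h1 : 1 / 2 ≤ ‖z + 1 + (√(l i) : ℝ) * Complex.I‖ := by
      refine le_trans ?_ ((le_abs_self _).trans (Complex.abs_re_le_norm _))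
      simp; linarith
    have h2 : 1 / 2 ≤ ‖z + 1 - (√(l i) : ℝ) * Complex.I‖ := by
      refine le_trans ?_ ((le_abs_self _).trans (Complex.abs_re_le_norm _))
      simp; linarith
    rw [hfac, norm_mul]
    calc (1 / 4 : ℝ) = 1 / 2 * (1 / 2) := by norm_num
      _ ≤ _ := by gcongr
  have hterm : ∀ i, ∀ z ∈ U, ‖(c i : ℂ) / ((z + 1) ^ 2 + (l i : ℂ))‖ ≤ 4 * |c i| := by
    intro i z hz
    have h1 := hden i z hz
    rw [norm_div, Complex.norm_real, Real.norm_eq_abs, div_le_iff₀ (by linarith)]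
    nlinarith [abs_nonneg (c i)]
  have hd : DifferentiableOn ℂ Φ U := by
    refine Complex.differentiableOn_tsum_of_summable_norm (hcs.mul_left 4) (fun i => ?_) hUo hterm
    refine DifferentiableOn.div (by fun_prop) (by fun_prop) fun z hz h0 => ?_
    have := hden i z hz
    rw [h0, norm_zero] at this
    norm_num at this
  have hbd : ∀ z ∈ U, ‖Φ z‖ ≤ ∑' i, 4 * |c i| := fun z hz =>
    tsum_of_norm_bounded (hcs.mul_left 4).hasSum fun i => hterm i z hz
  have hval : ∀ t : ℝ, ∀ x : A.op.domain, A.op x + ((t + 1) ^ 2) • (x : H) = h →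
      Φ t = ((⟪v₀, (x : H)⟫_ℝ : ℝ) : ℂ) := by
    intro t x hx
    have h1 := huy (x : H)
    refine HasSum.tsum_eq ?_
    rw [← Complex.hasSum_ofReal] at h1
    convert h1 using 2 with i
    obtain ⟨hl0, y, hy, hAy⟩ := hl i
    have h2 : c i = ((t + 1) ^ 2 + l i) * ⟪u i, (x : H)⟫_ℝ := by
      rw [hc]
      simp only
      rw [← hx, inner_add_right, real_inner_smul_right, ← hy, ← A.symm, hAy, ← hy,
        real_inner_smul_left]
      ring
    have h3 : ((t : ℂ) + 1) ^ 2 + l i ≠ 0 := by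
      have : (0 : ℝ) < (t + 1) ^ 2 + l i := by positivity
      exact_mod_cast this.ne'
    rw [div_eq_iff h3, h2]
    push_cast
    ring
  have hsub : {z : ℂ | 0 ≤ z.re} ⊆ U := fun z hz => by
    have : 0 ≤ z.re := hz
    show -(1 / 2) < z.re
    linarith
  have hzero : EqOn Φ 0 {z : ℂ | 0 ≤ z.re} := by
    refine PhragmenLindelof.eq_zero_on_right_half_plane_of_superexponential_decay ?_ ?_ ?_ ?_
    · refine DifferentiableOn.diffContOnCl (hd.mono ?_)
      rw [Complex.closure_setOfPred_lt_re]
      exact hsub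
    · refine ⟨0, by norm_num, 0, ?_⟩
      refine Asymptotics.IsBigO.of_bound (∑' i, 4 * |c i|) ?_
      filter_upwards [mem_inf_of_right (mem_principal_self _)] with z hz
      simpa using hbd z (hsub (le_of_lt hz))
    · have hC' : ∀ t : ℝ, 0 ≤ t → ‖Φ t‖ ≤ |C| * (8 / T ^ 2) * Real.exp (-(T / 2 * t ^ 2)) := by
        intro t ht
        set p : ℝ := ((t + 1) ^ 2) ^ m⁻¹ with hp
        have ht1 : (1 : ℝ) ≤ (t + 1) ^ 2 := by nlinarith
        have hpm : p ^ m = (t + 1) ^ 2 := by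
          rw [hp, ← Real.rpow_mul (by positivity), inv_mul_cancel₀ hm0.ne', Real.rpow_one]
        have hpt : (t + 1) ^ 2 ≤ p := by
          have := Real.rpow_le_rpow_of_exponent_le ht1 ((one_le_inv₀ hm0).mpr hm1)
          rwa [Real.rpow_one] at this
        have hp0 : 0 ≤ p := by linarith
        obtain ⟨x, hx⟩ := A.exists_op_add_smul_eq ht1 h
        rw [hval t x hx, Complex.norm_real, Real.norm_eq_abs]
        have h1 := hdec p (ht1.trans hpt) x (by rw [hpm, hx])
        have h2 := Real.quadratic_le_exp_of_nonneg (x := p * T / 2) (by positivity)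
        -- Half of the exponential absorbs p², by x²/2 ≤ e^x at x = pT/2.
        have h3 : p ^ 2 ≤ 8 / T ^ 2 * Real.exp (p * T / 2) := by
          rw [div_mul_eq_mul_div, le_div_iff₀ (by positivity)]
          nlinarith [mul_nonneg hp0 hT.le]
        calc _ ≤ _ := h1
          _ ≤ |C| * p ^ 2 * Real.exp (-(p * T)) := by gcongr; exact le_abs_self C
          _ ≤ |C| * (8 / T ^ 2 * Real.exp (p * T / 2)) * Real.exp (-(p * T)) := by gcongr
          _ = |C| * (8 / T ^ 2) * Real.exp (-(T / 2 * p)) := by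
            rw [show -(T / 2 * p) = p * T / 2 + -(p * T) by ring, Real.exp_add]; ring
          _ ≤ _ := by
            gcongr
            nlinarith
      rw [Asymptotics.superpolynomialDecay_iff_abs_tendsto_zero]
      intro n
      have hlim : Tendsto (fun t : ℝ => |C| * (8 / T ^ 2) * Real.exp (t * (n - T / 2 * t))) atTop
          (𝓝 (|C| * (8 / T ^ 2) * 0)) := by
        refine (Real.tendsto_exp_atBot.comp ?_).const_mul _
        refine tendsto_id.atTop_mul_atBot₀ ?_
        refine tendsto_atBot_add_const_left _ (n : ℝ) ?_
        exact tendsto_neg_atTop_atBot.comp (tendsto_id.const_mul_atTop (by positivity))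
      rw [mul_zero] at hlim
      refine squeeze_zero' (Eventually.of_forall fun t => abs_nonneg _) ?_ hlim
      filter_upwards [eventually_ge_atTop 0] with t ht
      rw [abs_of_nonneg (by positivity)]
      calc _ ≤ Real.exp t ^ n * (|C| * (8 / T ^ 2) * Real.exp (-(T / 2 * t ^ 2))) := by
            gcongr; exact hC' t ht
        _ = _ := by
            rw [show t * (n - T / 2 * t) = n * t + -(T / 2 * t ^ 2) by ring, Real.exp_add,
              Real.exp_nat_mul]; ring
    · exact ⟨∑' i, 4 * |c i|, fun t => hbd _ (hsub (by simp))⟩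
  have hq0 : (0 : ℝ) ≤ √q - 1 := by
    have := Real.one_le_sqrt.mpr hq
    linarith
  have h1 := hval (√q - 1) x (by rw [sub_add_cancel, Real.sq_sqrt (by linarith), hx])
  rw [hzero (show (0 : ℝ) ≤ ((√q - 1 : ℝ) : ℂ).re from hq0)] at h1
  exact (Complex.ofReal_eq_zero.mp h1.symm)

end EllipticOperator

/-! ### Weak solutions of the backward system -/

theorem rightRL_dual_apply {X V : Type*} [NormedAddCommGroup X] [NormedSpace ℝ X] [CompleteSpace X]
    [NormedAddCommGroup V] [NormedSpace ℝ V] (L : X →L[ℝ] StrongDual ℝ V) {T α t : ℝ}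
    {u : ℝ → X} (h : RightRLExists T α u t) (y : V) :
    rightRL T α (fun τ => L (u τ)) t y = rightRL T α (fun τ => L (u τ) y) t :=
  (rightRL_clm (ContinuousLinearMap.apply ℝ ℝ y) (h.clm L)).symm

/-- The Hilfer derivative of a function with values in a dual space, in components. -/
theorem HasRightHilferDeriv.exists_components {V : Type*} [NormedAddCommGroup V] [NormedSpace ℝ V]
    {T μ ν : ℝ} {u d : ℝ → StrongDual ℝ V} (h : HasRightHilferDeriv T μ ν u d) (hT : 0 < T)
    (h1 : ν * (1 - μ) ≤ 1) :
    ∃ w : ℝ → V → ℝ,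
      (∀ y : V, ∀ s ∈ Ico 0 T, ∀ t ∈ Ico 0 T,
        rightRL T ((1 - ν) * (1 - μ)) u t y - rightRL T ((1 - ν) * (1 - μ)) u s y
          = ∫ τ in s..t, w τ y) ∧
      (∀ y : V, ∀ᵐ t ∂(volume.restrict (Ioo 0 T)),
        d t y = - rightRL T (ν * (1 - μ)) (fun τ => w τ y) t) ∧
      (ν * (1 - μ) ≠ 0 → ∃ C : ℝ, 0 ≤ C ∧ ∀ y : V, IntegrableOn (fun t => w t y) (Ioo 0 T) ∧
        ∫ t in Ioo 0 T, |w t y| ≤ C * ‖y‖) := by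
  obtain ⟨-, w', hloc, hprim, hae⟩ := h
  refine ⟨fun t y => w' t y, fun y s hs t ht => ?_, fun y => ?_, fun hg => ?_⟩
  · have hwi : IntervalIntegrable w' volume s t := by
      rw [intervalIntegrable_iff']
      exact hloc.integrableOn_compact_subset (fun r hr => ⟨(le_min hs.1 ht.1).trans hr.1,
        hr.2.trans_lt (max_lt hs.2 ht.2)⟩) isCompact_uIcc
    rw [← sub_apply, hprim s hs t ht, ContinuousLinearMap.intervalIntegral_apply hwi]
  · filter_upwards [hae] with t h2
    have h3 := rightRL_clm (ContinuousLinearMap.apply ℝ ℝ y) h2.1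
    simp only [ContinuousLinearMap.apply_apply] at h3
    rw [h3, h2.2, neg_apply]
  · have hne : (ae (volume.restrict (Ioo 0 T))).NeBot := by
      rw [ae_neBot, Ne, Measure.restrict_eq_zero, Real.volume_Ioo]
      simpa using hT
    -- A single good time t suffices: local integrability covers [0,t], and existence of the
    -- fractional integral at t covers (t,T).
    obtain ⟨t, ⟨ht, -⟩, ht'⟩ := (hae.and (ae_restrict_mem measurableSet_Ioo)).exists
    have hi : IntegrableOn w' (Ioo 0 T) := by
      have h1' := hloc.integrableOn_compact_subset (Icc_subset_Ico_right ht'.2)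
        (isCompact_Icc (a := (0 : ℝ)) (b := t))
      refine (h1'.union (ht.integrableOn hg h1)).mono_set fun s hs => ?_
      rcases le_or_gt s t with h | h
      · exact Or.inl ⟨hs.1.le, h⟩
      · exact Or.inr ⟨h, hs.2⟩
    refine ⟨∫ t in Ioo 0 T, ‖w' t‖, integral_nonneg fun _ => norm_nonneg _, fun y => ?_⟩
    have hix := (ContinuousLinearMap.apply ℝ ℝ y).integrable_comp hi
    refine ⟨hix, ?_⟩
    rw [← integral_mul_const]
    exact integral_mono hix.abs (hi.norm.mul_const _) fun t => (w' t).le_opNorm y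

theorem integral_exp_neg_mul_sub {T p : ℝ} (hT : 0 ≤ T) (hp0 : 0 < p) :
    ∫ t in Ioo 0 T, Real.exp (-(p * (T - t))) = (1 - Real.exp (-(p * T))) / p := by
  rw [← integral_Ioc_eq_integral_Ioo, ← intervalIntegral.integral_of_le hT]
  have hd : ∀ t ∈ uIcc 0 T, HasDerivAt (fun t => Real.exp (-(p * (T - t))) / p)
      (Real.exp (-(p * (T - t)))) t := by
    intro t _
    have h1 : HasDerivAt (fun t => -(p * (T - t))) p t := by
      simpa using (((hasDerivAt_id' t).const_sub T).const_mul p).fun_neg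
    have h2 := h1.exp.div_const p
    rwa [mul_div_assoc, div_self hp0.ne', mul_one] at h2
  rw [intervalIntegral.integral_eq_sub_of_hasDerivAt hd
    (by apply Continuous.intervalIntegrable; fun_prop)]
  simp [sub_div]

/-- Combination of the three truncated Laplace transform estimates of the weak equation. -/
theorem laplace_estimate_combine {p μ β γ E a La Lf Lk Lw nk nf : ℝ} (hp : 1 ≤ p) (hμ0 : 0 < μ)
    (hβ0 : 0 ≤ β) (hγ0 : 0 ≤ γ) (hsum : μ = 1 - γ - β) (hE0 : 0 < E) (hnk : 0 ≤ nk) (hnf : 0 ≤ nf)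
    (e1 : |La - p ^ (-γ) * Lk| ≤ p ^ (-γ) * E * nk)
    (e2 : |(1 - E) / p * a - Lw - p ^ (-1 : ℝ) * Lk| ≤ p ^ (-1 : ℝ) * E * nk)
    (e3 : |Lw - p ^ (-β) * Lf| ≤ p ^ (-β) * E * nf) :
    |La + p ^ μ * Lf - p ^ (-γ) * a| ≤ p * E * (2 * nk + |a| + nf) := by
  have hp0 : 0 < p := by linarith
  have hpg1 : p ^ (-γ) ≤ 1 := Real.rpow_le_one_of_one_le_of_nonpos hp (by linarith)
  have hpb1 : p ^ (-β) ≤ 1 := Real.rpow_le_one_of_one_le_of_nonpos hp (by linarith)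
  have hpg0 : 0 < p ^ (-γ) := Real.rpow_pos_of_pos hp0 _
  have hpp : p ^ μ = p * p ^ (-γ) * p ^ (-β) := by
    rw [← Real.rpow_one_add' hp0.le (fun h0 => by linarith), ← Real.rpow_add hp0,
      show 1 + -γ + -β = μ by linarith]
  have hp1 : p ^ (-1 : ℝ) = p⁻¹ := Real.rpow_neg_one p
  rw [hp1] at e2
  -- Elimination of `Lk` between the first two estimates and of `Lw` by the third; the powers of p
  -- match because 1 - γ - β = μ.
  have hid : La + p ^ μ * Lf - p ^ (-γ) * a = (La - p ^ (-γ) * Lk) - p ^ (-γ) * (E * a)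
      - p * p ^ (-γ) * ((1 - E) / p * a - Lw - p⁻¹ * Lk) - p * p ^ (-γ) * (Lw - p ^ (-β) * Lf) := by
    rw [hpp]
    field_simp
    ring
  have b1 : |La - p ^ (-γ) * Lk| ≤ p * E * nk := e1.trans (by gcongr; exact hpg1.trans hp)
  have b2 : |p ^ (-γ) * (E * a)| ≤ p * E * |a| := by
    rw [abs_mul, abs_mul, abs_of_pos hpg0, abs_of_pos hE0, ← mul_assoc]
    gcongr
    exact hpg1.trans hp
  have b3 : |p * p ^ (-γ) * ((1 - E) / p * a - Lw - p⁻¹ * Lk)| ≤ p * E * nk := by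
    rw [abs_mul, abs_of_pos (by positivity)]
    calc _ ≤ p * 1 * (1 * E * nk) := by
          gcongr
          exact e2.trans (by gcongr; exact inv_le_one_of_one_le₀ hp)
      _ = _ := by ring
  have b4 : |p * p ^ (-γ) * (Lw - p ^ (-β) * Lf)| ≤ p * E * nf := by
    rw [abs_mul, abs_of_pos (by positivity)]
    calc _ ≤ p * 1 * (1 * E * nf) := by
          gcongr
          exact e3.trans (by gcongr)
      _ = _ := by ring
  rw [hid]
  calc _ ≤ p * E * nk + p * E * |a| + p * E * nk + p * E * nf :=
        (abs_sub _ _).trans (add_le_add ((abs_sub _ _).trans (add_le_add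
          ((abs_sub _ _).trans (add_le_add b1 b2)) b3)) b4)
    _ = _ := by ring

namespace EllipticOperator

variable {H : Type*} [NormedAddCommGroup H] [InnerProductSpace ℝ H] [CompleteSpace H]

/-- The embedding of the domain of the operator into the form domain. -/
noncomputable def domainToV (A : EllipticOperator H) (x : A.op.domain) : A.V :=
  UniformSpace.Completion.coe' (α := A.FormCore) x

theorem norm_formCore_le (A : EllipticOperator H) (x : A.FormCore) :
    ‖x‖ ≤ ‖A.incl x‖ + ‖A.app x‖ := by
  have h1 := A.inner_formCore x x
  rw [real_inner_self_eq_norm_sq, real_inner_self_eq_norm_sq] at h1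
  have h2 := real_inner_le_norm (A.app x) (A.incl x)
  have h3 := norm_nonneg (A.incl x)
  have h4 := norm_nonneg (A.app x)
  refine abs_le_of_sq_le_sq' ?_ (by positivity) |>.2
  nlinarith

theorem norm_domainToV_le (A : EllipticOperator H) (x : A.op.domain) :
    ‖A.domainToV x‖ ≤ ‖(x : H)‖ + ‖A.op x‖ :=
  (UniformSpace.Completion.norm_coe (E := A.FormCore) x).trans_le (A.norm_formCore_le x)

theorem toH_domainToV (A : EllipticOperator H) (x : A.op.domain) :
    A.toH (A.domainToV x) = x :=
  A.toH_coe x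

theorem form_domainToV (A : EllipticOperator H) (u : A.V) (x : A.op.domain) :
    A.form u (A.domainToV x) = ⟪A.toH u, A.op x⟫_ℝ := by
  have h : A.form (A.domainToV x) u = ⟪A.op x, A.toH u⟫_ℝ := A.form_coe_left x u
  rw [real_inner_comm, ← h, form, form, real_inner_comm, real_inner_comm (A.toH u)]

/-! ### Laplace transform of the weak equation and vanishing of the solution -/

namespace IsWeakBackwardSolution

variable {A : EllipticOperator H} {T μ ν : ℝ} {v₀ : H} {v : ℝ → A.V}

/-- At order ν(1-μ) = 0 the final condition concerns v itself, which then extends continuously to T;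
otherwise the fractional integral at t = 0 controls v. -/
theorem integrableOn (hv : A.IsWeakBackwardSolution T μ ν v₀ v) (hT : 0 < T)
    (hμ0 : 0 < μ) (hν0 : 0 ≤ ν) (hν1 : ν ≤ 1) :
    IntegrableOn (fun t => A.toH (v t)) (Ioo 0 T) := by
  have h0 : (0 : ℝ) ∈ Ico 0 T := ⟨le_rfl, hT⟩
  by_cases hb : ν * (1 - μ) = 0
  · have hcont := hv.rl_continuousOn
    have hlim := hv.final_condition
    have he : rightRL T (ν * (1 - μ)) (fun τ => A.toH (v τ)) = fun τ => A.toH (v τ) := by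
      funext t; rw [rightRL, if_pos hb]
    rw [he] at hcont hlim
    have hl := (hcont 0 h0).mono_left (nhdsWithin_mono 0 Ioo_subset_Ico_self)
    rw [nhdsWithin_Ioo_eq_nhdsGT hT] at hl
    have hc := hcont.mono Ioo_subset_Ico_self
    have hi := (continuousOn_Icc_extendFrom_Ioo hc hl hlim).integrableOn_Icc (μ := volume)
    exact (hi.mono_set Ioo_subset_Icc_self).congr_fun (fun t ht => extendFrom_extends hc t ht)
      measurableSet_Ioo
  · exact (hv.rl_exists 0 h0).integrableOn hb (by nlinarith)

/-- The components of the weak equation along the domain of the operator. -/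
theorem exists_components (hv : A.IsWeakBackwardSolution T μ ν v₀ v) (hT : 0 < T)
    (hμ0 : 0 < μ) (hν0 : 0 ≤ ν) (hν1 : ν ≤ 1) :
    ∃ C : ℝ, 0 ≤ C ∧ ∀ x : A.op.domain, ∃ k : ℝ → ℝ, IntegrableOn k (Ioo 0 T) ∧
      ∫ t in Ioo 0 T, |k t| ≤ C * (‖(x : H)‖ + ‖A.op x‖) ∧
      (∀ᵐ t ∂(volume.restrict (Ioo 0 T)),
        rightRL T ((1 - ν) * (1 - μ)) k t = ⟪A.toH (v t), A.op x⟫_ℝ) ∧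
      ∀ t ∈ Ioo 0 T, rightRL T 1 k t = ⟪v₀, (x : H)⟫_ℝ
        - rightRL T (ν * (1 - μ)) (fun τ => ⟪A.toH (v τ), (x : H)⟫_ℝ) t := by
  obtain ⟨d, hd, -, heq⟩ := hv.equation
  obtain ⟨w, hprim, hae, hint⟩ := hd.exists_components hT (by nlinarith)
  rw [sub_sub_cancel] at hprim
  have hUi := hv.integrableOn hT hμ0 hν0 hν1
  have hcomp : ∀ x : A.op.domain, ∀ᵐ t ∂(volume.restrict (Ioo 0 T)),
      rightRL T ((1 - ν) * (1 - μ)) (fun τ => w τ (A.domainToV x)) t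
        = ⟪A.toH (v t), A.op x⟫_ℝ := by
    intro x
    filter_upwards [hae (A.domainToV x), heq (A.domainToV x)] with t h1 h2
    rw [h1, form_domainToV] at h2
    linarith
  have hbound : ∃ C : ℝ, 0 ≤ C ∧ ∀ x : A.op.domain,
      IntegrableOn (fun t => w t (A.domainToV x)) (Ioo 0 T) ∧
      ∫ t in Ioo 0 T, |w t (A.domainToV x)| ≤ C * (‖(x : H)‖ + ‖A.op x‖) := by
    -- At order 0 no outer integral provides integrability up to T; instead the equation identifies
    -- the derivative component with (v, A x).
    by_cases hg : (1 - ν) * (1 - μ) = 0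
    · refine ⟨∫ t in Ioo 0 T, ‖A.toH (v t)‖, integral_nonneg fun _ => norm_nonneg _, fun x => ?_⟩
      have hk : ∀ᵐ t ∂(volume.restrict (Ioo 0 T)),
          w t (A.domainToV x) = ⟪A.toH (v t), A.op x⟫_ℝ := by
        filter_upwards [hcomp x] with t ht
        rwa [rightRL, if_pos hg] at ht
      have hi : IntegrableOn (fun t => ⟪A.toH (v t), A.op x⟫_ℝ) (Ioo 0 T) :=
        hUi.inner_const (A.op x)
      refine ⟨hi.congr (hk.mono fun t ht => ht.symm), ?_⟩
      rw [integral_congr_ae (hk.mono fun t ht => congrArg abs ht), ← integral_mul_const]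
      refine integral_mono hi.abs (hUi.norm.mul_const _) fun t => ?_
      refine (abs_real_inner_le_norm _ _).trans ?_
      gcongr
      exact le_add_of_nonneg_left (norm_nonneg _)
    · obtain ⟨C, hC0, hC⟩ := hint hg
      exact ⟨C, hC0, fun x => ⟨(hC _).1, (hC _).2.trans (by gcongr; exact A.norm_domainToV_le x)⟩⟩
  obtain ⟨C, hC0, hC⟩ := hbound
  refine ⟨C, hC0, fun x => ⟨_, (hC x).1, (hC x).2, hcomp x, fun t ht => ?_⟩⟩
  set y : A.V := A.domainToV x with hy
  have hki := (hC x).1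
  have hf : ∀ s ∈ Ico 0 T, rightRL T (ν * (1 - μ)) (fun τ => ⟪A.toH (v τ), (x : H)⟫_ℝ) s
      = ⟪rightRL T (ν * (1 - μ)) (fun τ => A.toH (v τ)) s, (x : H)⟫_ℝ := by
    intro s hs
    have := rightRL_clm (innerSL ℝ (x : H)) (hv.rl_exists s hs)
    simpa only [innerSL_apply_apply, real_inner_comm] using this
  have hΦ : ∀ s ∈ Ico 0 T, rightRL T (ν * (1 - μ)) (fun τ => A.toDual (A.toH (v τ))) s y
      = rightRL T (ν * (1 - μ)) (fun τ => ⟪A.toH (v τ), (x : H)⟫_ℝ) s := by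
    intro s hs
    have h1 := rightRL_dual_apply A.toDual (hv.rl_exists s hs) y
    simp only [toDual_apply, hy, toH_domainToV] at h1
    exact h1
  have ht0 : t ∈ Ico 0 T := ⟨ht.1.le, ht.2⟩
  have hprim' : ∀ s ∈ Ico t T, ∫ τ in t..s, w τ y
      = rightRL T (ν * (1 - μ)) (fun τ => ⟪A.toH (v τ), (x : H)⟫_ℝ) s
        - rightRL T (ν * (1 - μ)) (fun τ => ⟪A.toH (v τ), (x : H)⟫_ℝ) t := by
    intro s hs
    have hs0 : s ∈ Ico 0 T := ⟨ht.1.le.trans hs.1, hs.2⟩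
    rw [← hΦ s hs0, ← hΦ t ht0]
    exact (hprim y t ht0 s hs0).symm
  have hkt : IntegrableOn (fun τ => w τ y) (uIcc t T) := by
    rw [uIcc_of_le ht.2.le, integrableOn_Icc_iff_integrableOn_Ioo]
    exact hki.mono_set (Ioo_subset_Ioo_left ht.1.le)
  -- The primitive identity is known only below T; the final value v₀ enters in the limit s ↑ T.
  have hl1 : Tendsto (fun s => ∫ τ in t..s, w τ y) (𝓝[<] T) (𝓝 (∫ τ in t..T, w τ y)) := by
    have h1 := intervalIntegral.continuousOn_primitive_interval hkt T right_mem_uIcc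
    have h2 : Tendsto (fun s => ∫ τ in t..s, w τ y) (𝓝[Ioo t T] T) (𝓝 (∫ τ in t..T, w τ y)) :=
      h1.mono_left (nhdsWithin_mono T (by
        rw [uIcc_of_le ht.2.le]; exact Ioo_subset_Icc_self))
    rwa [nhdsWithin_Ioo_eq_nhdsLT ht.2] at h2
  have hl2 : Tendsto (fun s => ∫ τ in t..s, w τ y) (𝓝[<] T) (𝓝 (⟪v₀, (x : H)⟫_ℝ
      - rightRL T (ν * (1 - μ)) (fun τ => ⟪A.toH (v τ), (x : H)⟫_ℝ) t)) := by
    have h1 := (hv.final_condition.inner (tendsto_const_nhds (x := (x : H)))).sub_const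
      (rightRL T (ν * (1 - μ)) (fun τ => ⟪A.toH (v τ), (x : H)⟫_ℝ) t)
    refine h1.congr' ?_
    filter_upwards [Ico_mem_nhdsLT ht.2] with s hs
    rw [hprim' s hs, hf s ⟨ht.1.le.trans hs.1, hs.2⟩]
  rw [← tendsto_nhds_unique hl1 hl2, rightRL, if_neg one_ne_zero, Real.Gamma_one,
    intervalIntegral.integral_of_le ht.2.le, integral_Ioc_eq_integral_Ioo]
  simp

/-- The truncated Laplace transform of a weak solution is, up to a term of order `p e^(-pT)`, the
resolvent applied to the final value. -/
theorem exists_laplace_estimate (hv : A.IsWeakBackwardSolution T μ ν v₀ v) (hT : 0 < T)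
    (hμ0 : 0 < μ) (hμ1 : μ ≤ 1) (hν0 : 0 ≤ ν) (hν1 : ν ≤ 1) :
    ∃ C : ℝ, 0 ≤ C ∧ ∀ p : ℝ, 1 ≤ p → ∀ (x : A.op.domain) (h : H),
      A.op x + (p ^ μ) • (x : H) = h →
      |(∫ t in Ioo 0 T, Real.exp (-(p * (T - t))) * ⟪A.toH (v t), h⟫_ℝ)
        - p ^ (-((1 - ν) * (1 - μ))) * ⟪v₀, (x : H)⟫_ℝ| ≤ C * ‖h‖ * p * Real.exp (-(p * T)) := by
  obtain ⟨C, hC0, hC⟩ := hv.exists_components hT hμ0 hν0 hν1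
  have hUi := hv.integrableOn hT hμ0 hν0 hν1
  have hU0 : 0 ≤ ∫ t in Ioo 0 T, ‖A.toH (v t)‖ := integral_nonneg fun _ => norm_nonneg _
  have hγ0 : 0 ≤ (1 - ν) * (1 - μ) := mul_nonneg (by linarith) (by linarith)
  have hγ1 : (1 - ν) * (1 - μ) ≤ 1 := by nlinarith
  have hβ0 : 0 ≤ ν * (1 - μ) := mul_nonneg hν0 (by linarith)
  have hβ1 : ν * (1 - μ) ≤ 1 := by nlinarith
  -- The 4 is 2 · 2: `nk` occurs twice in the combined estimate, and ‖x‖ + ‖A x‖ ≤ 2‖h‖.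
  refine ⟨4 * C + ‖v₀‖ + ∫ t in Ioo 0 T, ‖A.toH (v t)‖, by positivity, fun p hp x h hx => ?_⟩
  have hp0 : 0 < p := by linarith
  obtain ⟨k, hki, hkn, hk1, hk2⟩ := hC x
  obtain ⟨hxn, hAxn⟩ := A.norm_le_of_resolvent_eq (Real.one_le_rpow hp hμ0.le) hx
  have hfi : IntegrableOn (fun t => ⟪A.toH (v t), (x : H)⟫_ℝ) (Ioo 0 T) := hUi.inner_const _
  have hfn : ∫ t in Ioo 0 T, |⟪A.toH (v t), (x : H)⟫_ℝ| ≤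
      (∫ t in Ioo 0 T, ‖A.toH (v t)‖) * ‖h‖ := by
    rw [← integral_mul_const]
    refine integral_mono hfi.abs (hUi.norm.mul_const _) fun t => ?_
    refine (abs_real_inner_le_norm _ _).trans ?_
    gcongr
  obtain ⟨i1, e1⟩ := laplace_rightRL hT hp0 hγ0 hγ1 hki
  obtain ⟨i2, e2⟩ := laplace_rightRL hT hp0 zero_le_one le_rfl hki
  obtain ⟨i3, e3⟩ := laplace_rightRL hT hp0 hβ0 hβ1 hfi
  set γ := (1 - ν) * (1 - μ) with hγ
  set β := ν * (1 - μ) with hβ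
  set E := Real.exp (-(p * T)) with hE
  have hE0 : 0 < E := Real.exp_pos _
  have hconst := integral_exp_neg_mul_sub hT.le hp0
  rw [← hE] at hconst
  have hci : IntegrableOn (fun t => Real.exp (-(p * (T - t)))) (Ioo 0 T) :=
    (Continuous.integrableOn_Icc (by fun_prop)).mono_set Ioo_subset_Icc_self
  have hexpi : ∀ z : H, IntegrableOn
      (fun t => Real.exp (-(p * (T - t))) * ⟪A.toH (v t), z⟫_ℝ) (Ioo 0 T) := by
    intro z
    refine (laplace_rightRL (α := 0) hT hp0 le_rfl zero_le_one
      (g := fun t => ⟪A.toH (v t), z⟫_ℝ) (hUi.inner_const _)).1.congr_fun (fun t _ => ?_)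
      measurableSet_Ioo
    simp [rightRL]
  have r1 : ∫ t in Ioo 0 T, Real.exp (-(p * (T - t))) * rightRL T γ k t
      = ∫ t in Ioo 0 T, Real.exp (-(p * (T - t))) * ⟪A.toH (v t), A.op x⟫_ℝ :=
    integral_congr_ae (hk1.mono fun t ht => by simp only [ht])
  have r2 : ∫ t in Ioo 0 T, Real.exp (-(p * (T - t))) * rightRL T 1 k t
      = (1 - E) / p * ⟪v₀, (x : H)⟫_ℝ - ∫ t in Ioo 0 T, Real.exp (-(p * (T - t))) *
        rightRL T β (fun τ => ⟪A.toH (v τ), (x : H)⟫_ℝ) t := by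
    rw [← hconst, ← integral_mul_const, ← integral_sub (hci.mul_const _) i3]
    refine setIntegral_congr_fun measurableSet_Ioo fun t ht => ?_
    simp only [hk2 t ht]; ring
  have r3 : ∫ t in Ioo 0 T, Real.exp (-(p * (T - t))) * ⟪A.toH (v t), h⟫_ℝ
      = (∫ t in Ioo 0 T, Real.exp (-(p * (T - t))) * ⟪A.toH (v t), A.op x⟫_ℝ) + p ^ μ *
        ∫ t in Ioo 0 T, Real.exp (-(p * (T - t))) * ⟪A.toH (v t), (x : H)⟫_ℝ := by
    rw [← integral_const_mul, ← integral_add (hexpi _) ((hexpi _).const_mul _)]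
    refine integral_congr_ae (ae_of_all _ fun t => ?_)
    simp only
    rw [← hx, inner_add_right, real_inner_smul_right]; ring
  rw [r1] at e1
  rw [r2] at e2
  rw [r3]
  set La := ∫ t in Ioo 0 T, Real.exp (-(p * (T - t))) * ⟪A.toH (v t), A.op x⟫_ℝ
  set Lf := ∫ t in Ioo 0 T, Real.exp (-(p * (T - t))) * ⟪A.toH (v t), (x : H)⟫_ℝ
  set Lk := ∫ t in Ioo 0 T, Real.exp (-(p * (T - t))) * k t
  set Lw := ∫ t in Ioo 0 T, Real.exp (-(p * (T - t))) *
        rightRL T β (fun τ => ⟪A.toH (v τ), (x : H)⟫_ℝ) t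
  set nk := ∫ t in Ioo 0 T, |k t|
  set nf := ∫ t in Ioo 0 T, |⟪A.toH (v t), (x : H)⟫_ℝ|
  have hnk : 0 ≤ nk := integral_nonneg fun _ => abs_nonneg _
  have hnf : 0 ≤ nf := integral_nonneg fun _ => abs_nonneg _
  set a := ⟪v₀, (x : H)⟫_ℝ with ha
  have han : |a| ≤ ‖v₀‖ * ‖h‖ := (abs_real_inner_le_norm _ _).trans (by gcongr)
  have hkn' : nk ≤ 2 * C * ‖h‖ := hkn.trans (by nlinarith)
  refine (laplace_estimate_combine hp hμ0 hβ0 hγ0 (by rw [hγ, hβ]; ring) hE0 hnk hnf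
    e1 e2 e3).trans ?_
  calc _ ≤ p * E * (2 * (2 * C * ‖h‖) + ‖v₀‖ * ‖h‖
        + (∫ t in Ioo 0 T, ‖A.toH (v t)‖) * ‖h‖) := by gcongr
    _ = _ := by ring

/-- A weak solution is zero if it is orthogonal at almost all times to a set of test vectors that
detects eigenvectors. -/
theorem eq_zero_of_orthogonal (hv : A.IsWeakBackwardSolution T μ ν v₀ v) (hT : 0 < T)
    (hμ0 : 0 < μ) (hμ1 : μ ≤ 1) (hν0 : 0 ≤ ν) (hν1 : ν ≤ 1) (K : Set H)
    (hucp : ∀ l : ℝ, 0 < l → ∀ e : A.op.domain, A.op e = l • (e : H) →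
      (∀ h ∈ K, ⟪(e : H), h⟫_ℝ = 0) → (e : H) = 0)
    (hK : ∀ h ∈ K, ∀ᵐ t ∂(volume.restrict (Ioo 0 T)), ⟪A.toH (v t), h⟫_ℝ = 0) :
    ∀ t ∈ Ioo 0 T, A.toH (v t) = 0 := by
  obtain ⟨C, hC0, hC⟩ := hv.exists_laplace_estimate hT hμ0 hμ1 hν0 hν1
  have hγ1 : (1 - ν) * (1 - μ) ≤ 1 := by nlinarith
  have hv₀ : v₀ = 0 := by
    refine A.eq_zero_of_resolvents_orthogonal K hucp fun h hh q hq x hx => ?_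
    refine A.inner_resolvent_eq_zero_of_decay (C := C * ‖h‖) hT hμ0 hμ1 (fun p hp y hy => ?_) hq hx
    have h1 := hC p hp y h hy
    have h2 : ∫ t in Ioo 0 T, Real.exp (-(p * (T - t))) * ⟪A.toH (v t), h⟫_ℝ = 0 :=
      integral_eq_zero_of_ae ((hK h hh).mono fun t ht => by simp [ht])
    have hp0 : 0 < p := by linarith
    have hpg : 0 < p ^ (-((1 - ν) * (1 - μ))) := Real.rpow_pos_of_pos hp0 _
    rw [h2, zero_sub, abs_neg, abs_mul, abs_of_pos hpg, Real.rpow_neg hp0.le,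
      inv_mul_le_iff₀ (Real.rpow_pos_of_pos hp0 _)] at h1
    -- Removing p^(-γ) costs at most one more factor p, since γ ≤ 1.
    calc _ ≤ _ := h1
      _ ≤ p ^ (1 : ℝ) * (C * ‖h‖ * p * Real.exp (-(p * T))) := by gcongr
      _ = _ := by rw [Real.rpow_one]; ring
  intro s hs
  -- Since v₀ = 0 the Laplace estimate is now useful for every h. The choice h = v(s) makes the
  -- derivative at s of ∫_r^T (v(t), h) dt equal to -‖v(s)‖².
  set h := A.toH (v s) with hh
  have hfi : IntegrableOn (fun t => ⟪A.toH (v t), h⟫_ℝ) (Ioo 0 T) :=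
    (hv.integrableOn hT hμ0 hν0 hν1).inner_const _
  have hmom : ∀ n : ℕ, 1 ≤ n →
      |∫ t in Ioo 0 T, Real.exp (n * t) * ⟪A.toH (v t), h⟫_ℝ| ≤ C * ‖h‖ * n := by
    intro n hn
    have hn1 : (1 : ℝ) ≤ n := by exact_mod_cast hn
    obtain ⟨x, hx⟩ := A.exists_op_add_smul_eq (Real.one_le_rpow hn1 hμ0.le) h
    have h1 := hC n hn1 x h hx
    rw [hv₀, inner_zero_left, mul_zero, sub_zero] at h1
    have h2 : ∫ t in Ioo 0 T, Real.exp (-(n * (T - t))) * ⟪A.toH (v t), h⟫_ℝ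
        = Real.exp (-(n * T)) * ∫ t in Ioo 0 T, Real.exp (n * t) * ⟪A.toH (v t), h⟫_ℝ := by
      rw [← integral_const_mul]
      refine integral_congr_ae (ae_of_all _ fun t => ?_)
      simp only
      rw [← mul_assoc, ← Real.exp_add]
      congr 2; ring
    rw [h2, abs_mul, abs_of_pos (Real.exp_pos _), mul_comm] at h1
    exact le_of_mul_le_mul_right h1 (Real.exp_pos _)
  have hzero : ∀ r ∈ Ioo 0 T, ∫ t in r..T, ⟪A.toH (v t), h⟫_ℝ = 0 := by
    intro r hr
    rw [intervalIntegral.integral_of_le hr.2.le, integral_Ioc_eq_integral_Ioo]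
    exact integral_eq_zero_of_exp_moments hfi hmom hr
  have hcont : ContinuousOn (fun t => ⟪A.toH (v t), h⟫_ℝ) (Ioo 0 T) := by
    have h1 := hv.continuousOn.mono Ioo_subset_Ico_self
    exact (A.toH.continuous.comp_continuousOn h1).inner continuousOn_const
  have hii : IntervalIntegrable (fun t => ⟪A.toH (v t), h⟫_ℝ) volume s T := by
    rw [intervalIntegrable_iff_integrableOn_Ioo_of_le hs.2.le]
    exact hfi.mono_set (Ioo_subset_Ioo_left hs.1.le)
  have hder := intervalIntegral.integral_hasDerivAt_left hii
    (hcont.stronglyMeasurableAtFilter isOpen_Ioo s hs) (hcont.continuousAt (Ioo_mem_nhds hs.1 hs.2))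
  have hder0 : HasDerivAt (fun r => ∫ t in r..T, ⟪A.toH (v t), h⟫_ℝ) 0 s :=
    (hasDerivAt_const s (0 : ℝ)).congr_of_eventuallyEq
      (eventually_of_mem (Ioo_mem_nhds hs.1 hs.2) hzero)
  have := hder.unique hder0
  rw [neg_eq_zero] at this
  exact inner_self_eq_zero.mp this

end IsWeakBackwardSolution

end EllipticOperator

/-- Functions orthogonal to all functions supported in `ω` vanish in `ω`. -/
theorem ae_eq_zero_of_inner_eq_zero {N : ℕ} {Ω ω : Set (EuclideanSpace ℝ (Fin N))}
    (hω : MeasurableSet ω) (hωΩ : ω ⊆ Ω) {e : L2 Ω}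
    (he : ∀ h : L2 Ω, (∀ u : L2 Ω, (∀ᵐ x ∂(volume.restrict ω), u x = 0) → ⟪u, h⟫_ℝ = 0) →
      ⟪e, h⟫_ℝ = 0) : ∀ᵐ x ∂(volume.restrict ω), e x = 0 := by
  -- The test vector is e cut off to ω; its product with e is its own squared norm.
  have hmem : MemLp (indicator ω e) 2 (volume.restrict Ω) := (Lp.memLp e).indicator hω
  set h : L2 Ω := hmem.toLp _ with hh
  have hcoe : (h : EuclideanSpace ℝ (Fin N) → ℝ) =ᵐ[volume.restrict Ω] indicator ω e :=
    hmem.coeFn_toLp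
  have h1 : ⟪e, h⟫_ℝ = 0 := by
    refine he h fun u hu => ?_
    rw [L2.inner_def]
    refine integral_eq_zero_of_ae ?_
    have hu' : ∀ᵐ x ∂(volume.restrict Ω), x ∈ ω → u x = 0 :=
      ae_restrict_of_ae ((ae_restrict_iff' hω).mp hu)
    filter_upwards [hcoe, hu'] with x hx hx'
    rw [hx]
    by_cases hxω : x ∈ ω
    · simp [hx' hxω]
    · simp [indicator_of_notMem hxω]
  have h2 : ⟪h, h⟫_ℝ = 0 := by
    rw [← h1, L2.inner_def, L2.inner_def]
    refine integral_congr_ae ?_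
    filter_upwards [hcoe] with x hx
    rw [hx]
    by_cases hxω : x ∈ ω
    · rw [indicator_of_mem hxω]
    · rw [indicator_of_notMem hxω, inner_zero_right, inner_zero_right]
  have h3 : (h : EuclideanSpace ℝ (Fin N) → ℝ) =ᵐ[volume.restrict Ω] 0 :=
    Lp.eq_zero_iff_ae_eq_zero.mp (inner_self_eq_zero.mp h2)
  have h4 : ∀ᵐ x ∂(volume.restrict Ω), indicator ω e x = 0 := by
    filter_upwards [hcoe, h3] with x hx hx'
    rw [← hx, hx']; rfl
  filter_upwards [ae_restrict_of_ae_restrict_of_subset hωΩ h4, ae_restrict_mem hω] with x hx hxω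
  rwa [indicator_of_mem hxω] at hx

theorem mainTheorem3 {N : ℕ} (hN : 1 ≤ N)
    (Ω : Set (EuclideanSpace ℝ (Fin N))) (hΩ : IsOpen Ω) (hΩb : Bornology.IsBounded Ω)
    (A : EllipticOperator (L2 Ω))
    (μ ν T : ℝ) (hμ0 : 0 < μ) (hμ1 : μ ≤ 1) (hν0 : 0 ≤ ν) (hν1 : ν ≤ 1) (hT : 0 < T)
    (ω : Set (EuclideanSpace ℝ (Fin N))) (hω : IsOpen ω) (hωne : ω.Nonempty) (hωΩ : ω ⊆ Ω)
    (hucp : UniqueContinuation A ω)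
    (v₀ : L2 Ω) (v : ℝ → A.V) (hv : A.IsWeakBackwardSolution T μ ν v₀ v)
    (hzero : ∀ᵐ t ∂(volume.restrict (Ioo 0 T)),
      ∀ᵐ x ∂(volume.restrict ω), (A.toH (v t) : EuclideanSpace ℝ (Fin N) → ℝ) x = 0) :
    ∀ t ∈ Ioo 0 T,
      ∀ᵐ x ∂(volume.restrict Ω), (A.toH (v t) : EuclideanSpace ℝ (Fin N) → ℝ) x = 0 := by
  intro t ht
  -- The functions supported in ω are described by duality, so that orthogonality to v(t) is
  -- immediate from the vanishing of v.
  refine Lp.eq_zero_iff_ae_eq_zero.mp (hv.eq_zero_of_orthogonal hT hμ0 hμ1 hν0 hν1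
    {h : L2 Ω | ∀ u : L2 Ω, (∀ᵐ x ∂(volume.restrict ω), u x = 0) → ⟪u, h⟫_ℝ = 0}
    (fun l hl e he hK => ?_) (fun h hh => ?_) t ht)
  · exact Lp.eq_zero_iff_ae_eq_zero.mpr
      (hucp l hl e he (ae_eq_zero_of_inner_eq_zero hω.measurableSet hωΩ hK))
  · exact hzero.mono fun s hs => hh _ hs
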